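/- Let $p$ be a prime, $k$ an algebraically closed field of characteristic $p$, $G$ a finite group, and $\phi:G\to \mathrm{Aut}_k(k[[t]])$ an injective homomorphism into the group of (automatically continuous) $k$-algebra automorphisms. Let $P$ be a Sylow $p$-subgroup of $G$ and let $C$ be a complement of $P$ in $G$, i.e. a subgroup such that every element of $G$ is uniquely a product $xc$ with $x\in P$, $c\in C$. (The existence of $\phi$ implies that $P$ is normal and that $C$ exists and is cyclic of order prime to $p$, so $G$ is the semi-direct product of $P$ and $C$.) **Bertin obstruction.** For a finite group $H$ and an injection $\psi:H\to\mathrm{Aut}_k(k[[t]])$ let $i_\psi(h)=\mathrm{ord}_t(\psi(h)(t)-t)$ for $1\ne h\in H$, and let $a_\psi$ be the Artin character: $a_\psi(h)=-i_\psi(h)$ for $h\neq 1$ and $a_\psi(1)=\sum_{h\ne 1} i_\psi(h)$. The Bertin obstruction of $\psi$ vanishes if there is a finite $H$-set $S$, all of whose stabilizers are cyclic and non-trivial, such that the character of the action of $H$ on $S$ (number of fixed points) equals $-a_\psi$ on the non-trivial elements of $H$. If $\mathcal C_H$ is a set of representatives for the conjugacy classes of cyclic subgroups of $H$, there are unique rational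 numbers $b_{T,H}$ with $-a_\psi=\sum_{T\in\mathcal C_H} b_{T,H}\,1_T^H$, where $1_T^H$ is the character of $H$ induced from the trivial character of $T$; the number $b_{T,H}$ depends only on the conjugacy class of $T$. For a cyclic subgroup $T\subset P$ let $b_{T,P}$ be this number for $H=P$ and $\psi=\phi_P$, the restriction of $\phi$ to $P$. **Möbius sums.** For a non-trivial cyclic subgroup $T$ of $G$ put $$b'_{T,G}=\sum_{\Gamma\not\subset P}\mu([\Gamma:T]),\qquad b''_{T,G}=\sum_{\Gamma}\mu([\Gamma:T]),$$ where $\Gamma$ runs over the cyclic subgroups of $G$ which contain $T$ (and, in the first sum, are not contained in $P$) and $\mu$ is the Möbius function. **Characters.** Let $u$ be a uniformizer of the discrete valuation ring $k[[t]]^{\phi(P)}=k[[u]]$, and let $\theta:C\to k^*$ be the faithful character with $\phi(\sigma)(u)/u\equiv\theta(\sigma)$ mod $u\,k[[u]]$; it does not depend on $u$. If $C_1\subset C$ is a subgroup such that $\theta|_{C_1}$ takes values in $(\mathbb Z/p)^*\subset k^*$, its Teichmüller lift is the unique character $C_1\to\mathbb Z_p^*$ whose reduction mod $p$ is $\theta|_{C_1}$.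 For a non-trivial cyclic subgroup $T$ of $P$ let $\chi_T:\mathrm N_C(T)\to\mathbb Z_p^*$ be the unique character with $xyx^{-1}=y^{\chi_T(x)}$ for $x\in \mathrm N_C(T)$, $y\in T$. Here $\mathrm N_H(T)$ and $\mathrm C_H(T)$ are the normalizer and the centralizer of $T$ in $H$. **Theorem.** The Bertin obstruction of $\phi$ vanishes if and only if all the following conditions hold: (a) The Bertin obstruction of the restriction $\phi_P$ of $\phi$ to $P$ vanishes. (b) If $t$ is a non-trivial element of $C$, the centralizer $\mathrm C_G(t)$ is cyclic and equal to the (internal direct) product $\mathrm C_P(t)\times C=\mathrm C_P(C)\times C$. (c) For each non-trivial cyclic subgroup $T$ of $P$, both of the following hold: (i) $b'_{T,G}\equiv 0$ mod $[\mathrm N_P(T):T]\,\mathbb Z$; (ii) $[\mathrm N_P(T):T]\,b_{T,P}\ge -b'_{T,G}$. (d) For each non-trivial cyclic subgroup $T$ of $P$, one of the following is true: (i) $\mathrm C_C(T)$ is non-trivial, and $b''_{T,G}\equiv 0$ mod $\#\mathrm N_C(T)\,\mathbb Z$; (ii) $\mathrm C_C(T)$ is trivial, the restriction of $\theta$ to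 $\mathrm N_C(T)$ is faithful, takes values in $(\mathbb Z/p)^*$ and has Teichmüller lift $\chi_T^{-1}$, and $b'_{T,G}\equiv 0$ mod $\#\mathrm N_C(T)\,\mathbb Z$. -/

import Mathlib

open PowerSeries

noncomputable section

namespace BertinObstruction

/-! ## Group theory -/

section GroupTheory

variable {G : Type*} [Group G]

/-- The subgroup `H` is the internal direct product `A × B` of its subgroups `A` and `B`. -/
def IsInternalProduct (A B H : Subgroup G) : Prop :=
  A ⊔ B = H ∧ A ⊓ B = ⊥ ∧ ∀ a ∈ A, ∀ b ∈ B, a * b = b * a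

/-- `N_H(T)`, as a subgroup of the ambient group. -/
def normalizerIn (H T : Subgroup G) : Subgroup G :=
  Subgroup.normalizer (T : Set G) ⊓ H

/-- `C_H(T)`, as a subgroup of the ambient group. -/
def centralizerIn (H T : Subgroup G) : Subgroup G :=
  Subgroup.centralizer (T : Set G) ⊓ H

/-- `S_G(T)`: the set of all non-trivial cyclic subgroups of `G` which contain `T`. -/
def cyclicOver (T : Subgroup G) : Set (Subgroup G) :=
  {Γ | Γ ≠ ⊥ ∧ IsCyclic Γ ∧ T ≤ Γ}

/-- `b'_{T,G}`: the sum of `μ([Γ : T])` over the `Γ ∈ S_G(T)` which are not contained in `P`. -/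
def bPrime (P T : Subgroup G) : ℤ :=
  ∑ᶠ (Γ : Subgroup G) (_ : Γ ∈ cyclicOver T ∧ ¬ Γ ≤ P),
    ArithmeticFunction.moebius (T.relIndex Γ)

/-- `b''_{T,G}`: the sum of `μ([Γ : T])` over all `Γ ∈ S_G(T)`. -/
def bDoublePrime (T : Subgroup G) : ℤ :=
  ∑ᶠ (Γ : Subgroup G) (_ : Γ ∈ cyclicOver T), ArithmeticFunction.moebius (T.relIndex Γ)

/-- The character of the permutation representation of `G` on a finite `G`-set `S`: its value at
`g` is the number of fixed points of `g`. -/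
def permCharacter (S : Type*) [MulAction G S] (g : G) : ℕ :=
  Nat.card (MulAction.fixedBy S g)

/-- The character `1_T^G` induced from the trivial character of `T`, that is, the permutation
character of `G ⧸ T`. -/
def inducedTrivial (T : Subgroup G) (g : G) : ℕ :=
  permCharacter (G ⧸ T) g

/-- `𝒞` is a set of representatives for the conjugacy classes of cyclic subgroups of `G`. -/
def IsCyclicRepresentatives (𝒞 : Finset (Subgroup G)) : Prop :=
  (∀ T ∈ 𝒞, IsCyclic T) ∧
    ∀ T : Subgroup G, IsCyclic T →
      ∃! T' : Subgroup G, T' ∈ 𝒞 ∧ ∃ g : G, T' = T.map (MulAut.conj g).toMonoidHom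

end GroupTheory

/-! ## The Artin character and the Bertin obstruction

A local action is a homomorphism `φ` from `G` to the group of `k`-algebra automorphisms of
`k⟦X⟧` (these are automatically continuous); `X` plays the role of the uniformizer `t`. -/

section LocalActions

variable {k : Type*} [Field k] {G : Type*} [Group G]

/-- The function `i_G(g) = v(g(t) - t)` (used for `g ≠ 1` only). -/
def ramificationNumber (φ : G →* (k⟦X⟧ ≃ₐ[k] k⟦X⟧)) (g : G) : ℕ :=
  (φ g X - X).order.toNat

open Classical in
/-- The Artin character of `φ` (the residue field extension is trivial): it takes the value
`-i_G(g)` at `g ≠ 1`, and the value `∑_{s ≠ 1} i_G(s)` at `1`. -/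
def artinCharacter (φ : G →* (k⟦X⟧ ≃ₐ[k] k⟦X⟧)) (g : G) : ℤ :=
  if g = 1 then ∑ᶠ (s : G) (_ : s ≠ 1), (ramificationNumber φ s : ℤ)
  else -(ramificationNumber φ g : ℤ)

/-- The Bertin obstruction of `φ` vanishes: there is a finite `G`-set with non-trivial cyclic
stabilizers whose character equals `-a_φ` on the non-trivial elements of `G`. -/
def BertinVanishes (φ : G →* (k⟦X⟧ ≃ₐ[k] k⟦X⟧)) : Prop :=
  ∃ (S : Type) (_ : Finite S) (_ : MulAction G S),
    (∀ s : S, MulAction.stabilizer G s ≠ ⊥ ∧ IsCyclic (MulAction.stabilizer G s)) ∧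
    ∀ g : G, g ≠ 1 → (permCharacter S g : ℤ) = -artinCharacter φ g

/-- `q` is the coefficient of `1_T^G` in an expansion `-a_φ = ∑_{T' ∈ 𝒞} b_{T'} 1_{T'}^G` with
rational coefficients, where `𝒞` is a set of representatives, containing `T`, for the conjugacy
classes of cyclic subgroups of `G`. -/
def IsBertinConstant (φ : G →* (k⟦X⟧ ≃ₐ[k] k⟦X⟧)) (T : Subgroup G) (q : ℚ) : Prop :=
  ∃ (𝒞 : Finset (Subgroup G)) (b : Subgroup G → ℚ),
    IsCyclicRepresentatives 𝒞 ∧ T ∈ 𝒞 ∧ b T = q ∧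
    ∀ g : G, -(artinCharacter φ g : ℚ) = ∑ T' ∈ 𝒞, b T' * (inducedTrivial T' g : ℚ)

/-- `b_T = b_{T,G}(φ)`: the unique rational number which is the coefficient of `1_T^G` in the
expansion of `-a_φ`, for a cyclic subgroup `T` of `G`. -/
def bertinConstant (φ : G →* (k⟦X⟧ ≃ₐ[k] k⟦X⟧)) (T : Subgroup G) : ℚ :=
  Classical.epsilon (IsBertinConstant φ T)

/-- The ring of invariants `k⟦X⟧^{φ(P)}`. -/
def invariants (φ : G →* (k⟦X⟧ ≃ₐ[k] k⟦X⟧)) (P : Subgroup G) : Subalgebra k k⟦X⟧ where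
  carrier := {f | ∀ g ∈ P, φ g f = f}
  mul_mem' := fun ha hb g hg => by rw [map_mul, ha g hg, hb g hg]
  add_mem' := fun ha hb g hg => by rw [map_add, ha g hg, hb g hg]
  algebraMap_mem' := fun r g _ => (φ g).commutes r

/-- `θ(σ) ≡ φ(σ)(u)/u` modulo `u`, for every uniformizer (that is, irreducible element) `u` of the
discrete valuation ring `k⟦X⟧^{φ(P)} = k⟦u⟧` and every `σ ∈ C`. -/
def IsTameCharacter (φ : G →* (k⟦X⟧ ≃ₐ[k] k⟦X⟧)) (P C : Subgroup G) (θ : C →* kˣ) : Prop :=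
  ∀ u : invariants φ P, Irreducible u → ∀ σ : C, ∃ v : invariants φ P,
    φ σ (u : k⟦X⟧) = (u : k⟦X⟧) * (algebraMap k k⟦X⟧ (θ σ : k) + (u : k⟦X⟧) * (v : k⟦X⟧))

/-- The tame character `θ : C → k^*`: the unique character with `φ(σ)(u)/u ≡ θ(σ)` modulo `u`. -/
def tameCharacter (φ : G →* (k⟦X⟧ ≃ₐ[k] k⟦X⟧)) (P C : Subgroup G) : C →* kˣ :=
  Classical.epsilon (IsTameCharacter φ P C)

end LocalActions

/-! ## Teichmüller lifts and the conjugation character -/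

section PAdicCharacters

variable (p : ℕ) [Fact p.Prime]

/-- The character `η` of `A` takes values in `(ℤ/p)^* ⊆ k^*`. -/
def TakesValuesInPrimeField {k : Type*} [Field k] [CharP k p] {A : Type*} [Group A]
    (η : A →* kˣ) : Prop :=
  ∀ x : A, ∃ a : (ZMod p)ˣ, (η x : k) = ZMod.castHom (dvd_refl p) k (a : ZMod p)

/-- The reduction modulo `p` of the `p`-adic character `ψ` of `A` is `η`. -/
def IsTeichmullerLift {k : Type*} [Field k] [CharP k p] {A : Type*} [Group A]
    (η : A →* kˣ) (ψ : A →* ℤ_[p]ˣ) : Prop :=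
  ∀ x : A, ZMod.castHom (dvd_refl p) k (PadicInt.toZMod (ψ x : ℤ_[p])) = (η x : k)

/-- `x y x⁻¹ = y ^ χ(x)` for `x ∈ N` and `y ∈ T`. Here, for an element `y` with `y ^ (p ^ n) = 1`,
the power of `y` with exponent a `p`-adic integer is the one whose exponent is the class of this
`p`-adic integer modulo `p ^ n`. -/
def IsConjugationCharacter {G : Type*} [Group G] (N T : Subgroup G) (χ : N →* ℤ_[p]ˣ) : Prop :=
  ∀ (x : N), ∀ y ∈ T, ∀ n : ℕ, y ^ (p ^ n) = 1 →
    (x : G) * y * (x : G)⁻¹ = y ^ (PadicInt.toZModPow n (χ x : ℤ_[p])).val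

/-- `χ_T : N_C(T) → ℤ_p^*`: the unique character which gives the conjugation action of `N_C(T)`
on the cyclic `p`-group `T`. -/
def conjugationCharacter {G : Type*} [Group G] (C T : Subgroup G) :
    normalizerIn C T →* ℤ_[p]ˣ :=
  Classical.epsilon (IsConjugationCharacter p (normalizerIn C T) T)

/-- The restriction of a character of `C` to `N_C(T)`. -/
def restrictToNormalizer {k : Type*} [Field k] {G : Type*} [Group G] {C : Subgroup G}
    (θ : C →* kˣ) (T : Subgroup G) : normalizerIn C T →* kˣ :=
  θ.comp (Subgroup.inclusion inf_le_right)

end PAdicCharacters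

end BertinObstruction

end

/-!
Write `i(Γ)` for the value of `-a_φ` at the generators of a non-trivial cyclic subgroup `Γ`, and
`B_T = ∑ μ([Γ : T]) i(Γ)`, summed over the cyclic subgroups `Γ` containing `T`. If `S` is a `G`-set
with non-trivial cyclic stabilizers and character `-a_φ` off the identity, Möbius inversion shows
that `B_T` is the number of points of `S` with stabilizer exactly `T`, a set on which
`N_G(T) / T` acts freely. Conversely, natural numbers `B_T / [N_G(T) : T]` are the multiplicities
of the orbits `G / T` in such an `S`. So the obstruction vanishes if and only if
`0 ≤ B_T` and `[N_G(T) : T] ∣ B_T` for all non-trivial cyclic `T` (`bertinVanishes_iff`), and the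
same inversion gives `[N_P(T) : T] b_{T,P} = A_T`, where `A_T` is the part of `B_T` with `Γ ⊆ P`
(`relIndex_mul_bertinConstant`).

Let `θ₀` be the character by which `G` acts on the tangent space of `k⟦X⟧`. Leading coefficients
show that `P` is its kernel, so that `i(Γ) = 1` for `Γ ⊄ P`, and `B_T = A_T + b'_T` for `T ⊆ P`.

* If `T ⊄ P`, a conjugate of `T` meets `C` in some `t ≠ 1`. When `C_G(t)` is cyclic, it contains all
  cyclic overgroups of `T`, so that `B_T` is `1` if `T = C_G(t)` and `0` otherwise, and `C_G(t)`
  is its own normalizer (`moebiusSum_of_not_le`). Conversely, a non-trivial `t ∈ C` has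
  `i(t) = 1` fixed point in `S`, and `C_G(t)` lies in the cyclic stabilizer of that point
  (`IsBertinSet.exists_centralizer_le_stabilizer`). This is condition (b).
* If `T ⊆ P`, then after conjugation `[N_G(T) : T] = [N_P(T) : T] · #N_C(T)` with coprime factors
  (`exists_conj_relIndex_normalizer_eq`). The first factor and positivity give condition (c).
* The factor `#N_C(T)` gives condition (d). The basic relation is
  `θ₀(x) ^ (i(γ) - 1) = m` whenever `x γ x⁻¹ = γ ^ m` (`tangentCoeff_pow_eq`). If `C_C(T) ≠ 1`,
  it shows that `i(Γ) ≡ 1` modulo `#C` for `Γ` centralized by `C`, while the other `Γ` occur in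
  orbits of length `#C`, so `A_T` may be computed with all `i(Γ)` replaced by `1`
  (`normalizerIn_eq_and_card_dvd_of_centralizerIn_ne_bot`). If `C_C(T) = 1`, then `N_C(T)` acts
  freely on the fixed points of `T`, so `#N_C(T) ∣ i(T)` and `θ₀ = χ_T⁻¹` modulo `p`
  (`tangentCoeff_mul_eq_one_of_isBertinSet`); conversely this congruence makes `A_T` divisible by
  `#N_C(T)` (`card_dvd_of_tangentCoeff_mul_eq_one`).

Finally, the uniformizer of the invariants has `X`-order a power of `p`, so the tame character `θ`
is a power of Frobenius applied to `θ₀` (`exists_tameCharacter_eq`); the two agree as soon as either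
of them takes values in the prime field.
-/


noncomputable section

namespace BertinObstruction

/-! ### Möbius inversion over the cyclic subgroups of a finite group -/

section CyclicSubgroups

/-- The finite type of subgroups of a finite group. -/
@[reducible] def subgroupFintype (G : Type*) [Group G] [Finite G] : Fintype (Subgroup G) :=
  Fintype.ofFinite _

attribute [local instance] subgroupFintype

open scoped Classical in
/-- In a cyclic group `K`, a subgroup of order `n` consists of all solutions of `x ^ n = 1`, as there
are at most `n` of them. -/
theorem mem_iff_pow_card_eq_one {G : Type*} [Group G] [Finite G] {K Γ : Subgroup G}
    (hK : IsCyclic K) (h : Γ ≤ K) {x : G} : x ∈ Γ ↔ x ∈ K ∧ x ^ Nat.card Γ = 1 := by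
  refine ⟨fun hx => ⟨h hx, ?_⟩, fun ⟨hx, hx1⟩ => ?_⟩
  · exact congrArg Subtype.val (pow_card_eq_one' (x := (⟨x, hx⟩ : Γ)))
  · have := Fintype.ofFinite K
    have hle := IsCyclic.card_pow_eq_one_le (α := K) (n := Nat.card Γ) Nat.card_pos
    have hsub : (Finset.univ.filter fun y : K => (y : G) ∈ Γ) ⊆
        Finset.univ.filter fun y : K => y ^ Nat.card Γ = 1 := by
      intro y hy
      simp only [Finset.mem_filter, Finset.mem_univ, true_and] at hy ⊢
      have h1 := pow_card_eq_one' (x := (⟨(y : G), hy⟩ : Γ))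
      exact Subtype.ext (congrArg (Subtype.val : Γ → G) h1)
    have hcard : (Finset.univ.filter fun y : K => (y : G) ∈ Γ).card = Nat.card Γ := by
      rw [← Fintype.card_subtype, ← Nat.card_eq_fintype_card]
      exact Nat.card_congr (Subgroup.subgroupOfEquivOfLe h).toEquiv
    have heq := Finset.eq_of_subset_of_card_le hsub (hcard ▸ hle)
    have : (⟨x, hx⟩ : K) ∈ Finset.univ.filter fun y : K => y ^ Nat.card Γ = 1 := by
      simp [Subtype.ext_iff, hx1]
    rw [← heq] at this
    simpa using this

variable {G : Type*} [Group G] [Finite G]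

theorem relIndex_ne_zero_of_finite (T K : Subgroup G) : T.relIndex K ≠ 0 := by
  have : Finite (K ⧸ T.subgroupOf K) := Quotient.finite _
  exact Subgroup.index_ne_zero_of_finite

theorem card_mul_relIndex_of_le {G : Type*} [Group G] {T K : Subgroup G} (h : T ≤ K) :
    Nat.card T * T.relIndex K = Nat.card K := by
  rw [← Subgroup.relIndex_bot_left, Subgroup.relIndex_mul_relIndex _ _ _ bot_le h,
    Subgroup.relIndex_bot_left]

theorem le_iff_card_dvd_of_isCyclic {K Γ Γ' : Subgroup G} (hK : IsCyclic K) (h : Γ ≤ K)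
    (h' : Γ' ≤ K) : Γ ≤ Γ' ↔ Nat.card Γ ∣ Nat.card Γ' := by
  refine ⟨Subgroup.card_dvd_of_le, fun hd x hx => ?_⟩
  rw [mem_iff_pow_card_eq_one hK h] at hx
  rw [mem_iff_pow_card_eq_one hK h']
  obtain ⟨m, hm⟩ := hd
  exact ⟨hx.1, by rw [hm, pow_mul, hx.2, one_pow]⟩

theorem exists_subgroup_card_of_isCyclic {K : Subgroup G} (hK : IsCyclic K) {m : ℕ}
    (hm : m ∣ Nat.card K) : ∃ Γ ≤ K, Nat.card Γ = m := by
  obtain ⟨g, hg⟩ := hK.exists_ofOrder_eq_natCard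
  obtain ⟨d, hd⟩ := hm
  have hpos : 0 < Nat.card K := Nat.card_pos
  have hd0 : d ≠ 0 := by rintro rfl; simp_all
  refine ⟨Subgroup.zpowers ((g : G) ^ d), ?_, ?_⟩
  · rw [Subgroup.zpowers_le]
    exact K.pow_mem g.2 d
  · rw [Nat.card_zpowers, orderOf_pow_of_dvd hd0, Subgroup.orderOf_coe, hg, hd,
      Nat.mul_div_cancel _ (Nat.pos_of_ne_zero hd0)]
    rw [Subgroup.orderOf_coe, hg, hd]
    exact dvd_mul_left _ _

open scoped Classical in
/-- For cyclic `K`, the subgroups between `T` and `K` correspond to the divisors of `[K : T]`. -/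
theorem sum_Icc_eq_sum_divisors {T K : Subgroup G} (hK : IsCyclic K) (hTK : T ≤ K) (f : ℕ → ℤ) :
    ∑ Γ : Subgroup G with T ≤ Γ ∧ Γ ≤ K, f (T.relIndex Γ) =
      ∑ d ∈ (T.relIndex K).divisors, f d := by
  have hT : 0 < Nat.card T := Nat.card_pos
  have hn0 : T.relIndex K ≠ 0 := (relIndex_ne_zero_of_finite _ _)
  refine Finset.sum_bij (fun Γ _ => T.relIndex Γ) ?_ ?_ ?_ (fun _ _ => rfl)
  · intro Γ hΓ
    simp only [Finset.mem_filter, Finset.mem_univ, true_and] at hΓ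
    rw [Nat.mem_divisors]
    exact ⟨⟨_, (Subgroup.relIndex_mul_relIndex _ _ _ hΓ.1 hΓ.2).symm⟩, hn0⟩
  · intro Γ hΓ Γ' hΓ' h
    simp only [Finset.mem_filter, Finset.mem_univ, true_and] at hΓ hΓ'
    have hc : Nat.card Γ = Nat.card Γ' := by
      rw [← card_mul_relIndex_of_le hΓ.1, ← card_mul_relIndex_of_le hΓ'.1, h]
    exact le_antisymm ((le_iff_card_dvd_of_isCyclic hK hΓ.2 hΓ'.2).2 hc.dvd)
      ((le_iff_card_dvd_of_isCyclic hK hΓ'.2 hΓ.2).2 hc.symm.dvd)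
  · intro d hd
    have hd := Nat.dvd_of_mem_divisors hd
    obtain ⟨Γ, hΓ, hc⟩ := exists_subgroup_card_of_isCyclic hK (m := Nat.card T * d) (by
      rw [← card_mul_relIndex_of_le hTK]; exact mul_dvd_mul_left _ hd)
    have hTΓ : T ≤ Γ := (le_iff_card_dvd_of_isCyclic hK hTK hΓ).2 (hc ▸ dvd_mul_right _ _)
    refine ⟨Γ, by simp [hTΓ, hΓ], ?_⟩
    rw [← card_mul_relIndex_of_le hTΓ] at hc
    exact Nat.eq_of_mul_eq_mul_left hT hc

theorem sum_divisors_moebius (n : ℕ) :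
    ∑ d ∈ n.divisors, ArithmeticFunction.moebius d = if n = 1 then 1 else 0 := by
  have := congrArg (fun f => f n) ArithmeticFunction.coe_zeta_mul_moebius
  rw [ArithmeticFunction.coe_zeta_mul_apply, ArithmeticFunction.one_apply] at this
  exact this

theorem relIndex_eq_one_iff_eq {G : Type*} [Group G] {T K : Subgroup G} (hTK : T ≤ K) :
    T.relIndex K = 1 ↔ T = K := by
  rw [Subgroup.relIndex_eq_one]
  exact ⟨le_antisymm hTK, fun h => h.ge⟩

open scoped Classical in
theorem sum_moebius_relIndex_left {T K : Subgroup G} (hK : IsCyclic K) (hTK : T ≤ K) :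
    ∑ Γ : Subgroup G with T ≤ Γ ∧ Γ ≤ K, ArithmeticFunction.moebius (T.relIndex Γ) =
      if T = K then 1 else 0 := by
  rw [sum_Icc_eq_sum_divisors hK hTK, sum_divisors_moebius]
  simp [relIndex_eq_one_iff_eq hTK]

open scoped Classical in
theorem sum_moebius_relIndex_right {T K : Subgroup G} (hK : IsCyclic K) (hTK : T ≤ K) :
    ∑ Γ : Subgroup G with T ≤ Γ ∧ Γ ≤ K, ArithmeticFunction.moebius (Γ.relIndex K) =
      if T = K then 1 else 0 := by
  have h : ∑ Γ : Subgroup G with T ≤ Γ ∧ Γ ≤ K, ArithmeticFunction.moebius (Γ.relIndex K) =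
      ∑ Γ : Subgroup G with T ≤ Γ ∧ Γ ≤ K,
        (fun d => ArithmeticFunction.moebius (T.relIndex K / d)) (T.relIndex Γ) := by
    refine Finset.sum_congr rfl fun Γ hΓ => ?_
    simp only [Finset.mem_filter, Finset.mem_univ, true_and] at hΓ
    simp only
    rw [← Subgroup.relIndex_mul_relIndex _ _ _ hΓ.1 hΓ.2,
      Nat.mul_div_cancel_left _ (Nat.pos_of_ne_zero (relIndex_ne_zero_of_finite _ _))]
  rw [h, sum_Icc_eq_sum_divisors hK hTK
      (fun d => ArithmeticFunction.moebius (T.relIndex K / d)),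
    Nat.sum_div_divisors (T.relIndex K) (fun d => ArithmeticFunction.moebius d),
    sum_divisors_moebius]
  simp [relIndex_eq_one_iff_eq hTK]

/-- The Möbius transform of a function `F` on the subgroups of `G`, over the poset of cyclic
subgroups: `∑ μ([Γ : T]) F(Γ)` over the cyclic subgroups `Γ` containing `T`. -/
def moebiusSum {G : Type*} [Group G] [Finite G] {R : Type*} [CommRing R] (F : Subgroup G → R)
    (T : Subgroup G) : R :=
  open scoped Classical in
  ∑ Γ : Subgroup G with T ≤ Γ ∧ IsCyclic Γ,
    (ArithmeticFunction.moebius (T.relIndex Γ) : R) * F Γ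

open scoped Classical in
/-- Möbius inversion: the Möbius transform recovers `β` from its sums over cyclic overgroups. -/
theorem moebiusSum_eq_of_forall_eq_sum {R : Type*} [CommRing R] {F β : Subgroup G → R}
    {T : Subgroup G} (hT : IsCyclic T)
    (h : ∀ Γ : Subgroup G, IsCyclic Γ → T ≤ Γ →
      F Γ = ∑ K : Subgroup G with Γ ≤ K ∧ IsCyclic K, β K) :
    moebiusSum F T = β T := by
  unfold moebiusSum
  have h1 : ∑ Γ : Subgroup G with T ≤ Γ ∧ IsCyclic Γ,
        (ArithmeticFunction.moebius (T.relIndex Γ) : R) * F Γ =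
      ∑ Γ : Subgroup G with T ≤ Γ ∧ IsCyclic Γ, ∑ K : Subgroup G with Γ ≤ K ∧ IsCyclic K,
        (ArithmeticFunction.moebius (T.relIndex Γ) : R) * β K := by
    refine Finset.sum_congr rfl fun Γ hΓ => ?_
    simp only [Finset.mem_filter, Finset.mem_univ, true_and] at hΓ
    rw [h Γ hΓ.2 hΓ.1, Finset.mul_sum]
  rw [h1, Finset.sum_comm' (t' := Finset.univ.filter fun K : Subgroup G => T ≤ K ∧ IsCyclic K)
    (s' := fun K => Finset.univ.filter fun Γ : Subgroup G => T ≤ Γ ∧ Γ ≤ K)]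
  · have h2 : ∀ K ∈ Finset.univ.filter (fun K : Subgroup G => T ≤ K ∧ IsCyclic K),
        ∑ Γ : Subgroup G with T ≤ Γ ∧ Γ ≤ K,
          (ArithmeticFunction.moebius (T.relIndex Γ) : R) * β K =
        if T = K then β K else 0 := by
      intro K hK
      simp only [Finset.mem_filter, Finset.mem_univ, true_and] at hK
      rw [← Finset.sum_mul]
      have := congrArg (Int.cast : ℤ → R) (sum_moebius_relIndex_left hK.2 hK.1)
      rw [Int.cast_sum] at this
      rw [this]
      split_ifs <;> simp
    rw [Finset.sum_congr rfl h2, Finset.sum_ite_eq]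
    simp [hT]
  · intro Γ K
    simp only [Finset.mem_filter, Finset.mem_univ, true_and]
    refine ⟨fun ⟨⟨h1, _⟩, h2, h3⟩ => ⟨⟨h1, h2⟩, h1.trans h2, h3⟩, fun ⟨⟨h1, h2⟩, _, h3⟩ =>
      ⟨⟨h1, ?_⟩, h2, h3⟩⟩
    exact Subgroup.isCyclic_of_le h2

open scoped Classical in
/-- Möbius inversion in the other direction: `F` is recovered from its Möbius transform by summation
over cyclic overgroups. -/
theorem sum_moebiusSum {R : Type*} [CommRing R] (F : Subgroup G → R)
    {T : Subgroup G} (hT : IsCyclic T) :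
    ∑ K : Subgroup G with T ≤ K ∧ IsCyclic K, moebiusSum F K = F T := by
  unfold moebiusSum
  rw [Finset.sum_comm' (t' := Finset.univ.filter fun K : Subgroup G => T ≤ K ∧ IsCyclic K)
    (s' := fun K => Finset.univ.filter fun Γ : Subgroup G => T ≤ Γ ∧ Γ ≤ K)]
  · have h2 : ∀ K ∈ Finset.univ.filter (fun K : Subgroup G => T ≤ K ∧ IsCyclic K),
        ∑ Γ : Subgroup G with T ≤ Γ ∧ Γ ≤ K,
          (ArithmeticFunction.moebius (Γ.relIndex K) : R) * F K =
        if T = K then F K else 0 := by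
      intro K hK
      simp only [Finset.mem_filter, Finset.mem_univ, true_and] at hK
      rw [← Finset.sum_mul]
      have := congrArg (Int.cast : ℤ → R) (sum_moebius_relIndex_right hK.2 hK.1)
      rw [Int.cast_sum] at this
      rw [this]
      split_ifs <;> simp
    rw [Finset.sum_congr rfl h2, Finset.sum_ite_eq]
    simp [hT]
  · intro Γ K
    simp only [Finset.mem_filter, Finset.mem_univ, true_and]
    refine ⟨fun ⟨⟨h1, _⟩, h2, h3⟩ => ⟨⟨h1, h2⟩, h1.trans h2, h3⟩, fun ⟨⟨h1, h2⟩, _, h3⟩ =>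
      ⟨⟨h1, ?_⟩, h2, h3⟩⟩
    exact Subgroup.isCyclic_of_le h2

end CyclicSubgroups

/-! ### Permutation characters and points with a given stabilizer -/

section PermutationCharacters

attribute [local instance] subgroupFintype

/-- The number of points of a `G`-set whose stabilizer is exactly `T`. -/
def stabCount {G : Type*} [Group G] (S : Type*) [MulAction G S] (T : Subgroup G) : ℕ :=
  Nat.card {s : S // MulAction.stabilizer G s = T}

open scoped Classical in
theorem permCharacter_eq_sum_stabCount {G : Type*} [Group G] [Finite G] (S : Type*) [Finite S]
    [MulAction G S] (g : G) :
    permCharacter S g = ∑ T : Subgroup G with g ∈ T, stabCount S T := by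
  have := Fintype.ofFinite S
  have h1 : permCharacter S g = (Finset.univ.filter fun s : S => g • s = s).card := by
    rw [permCharacter, ← Fintype.card_subtype, ← Nat.card_eq_fintype_card]
    rfl
  rw [h1, Finset.card_eq_sum_card_fiberwise (f := fun s => MulAction.stabilizer G s)
    (t := Finset.univ.filter fun T : Subgroup G => g ∈ T)]
  · refine Finset.sum_congr rfl fun T hT => ?_
    simp only [Finset.mem_filter, Finset.mem_univ, true_and] at hT
    rw [stabCount, Nat.card_eq_fintype_card, Fintype.card_subtype]
    congr 1
    ext s
    simp only [Finset.mem_filter, Finset.mem_univ, true_and, and_iff_right_iff_imp]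
    rintro rfl
    exact hT
  · intro s hs
    simpa using hs

variable {G : Type*} [Group G]

theorem map_conj_eq_iff_mem_normalizer (T : Subgroup G) (g : G) :
    T.map (MulAut.conj g).toMonoidHom = T ↔ g ∈ Subgroup.normalizer (T : Set G) := by
  rw [Subgroup.mem_normalizer_iff]
  constructor
  · intro h x
    constructor
    · intro hx
      rw [← h]
      exact ⟨x, hx, rfl⟩
    · intro hx
      have hx : g * x * g⁻¹ ∈ T := hx
      rw [← h] at hx
      obtain ⟨y, hy, hyx⟩ := hx
      have : y = x := by simpa using hyx
      exact this ▸ hy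
  · intro h
    ext x
    constructor
    · rintro ⟨y, hy, rfl⟩
      exact (h y).1 hy
    · intro hx
      refine ⟨g⁻¹ * x * g, (h _).2 (by simpa [mul_assoc] using hx), by simp [mul_assoc]⟩

/-- `N(T) / T` acts freely on the points with stabilizer `T`. -/
theorem relIndex_normalizer_dvd_stabCount (S : Type*) [Finite S]
    [MulAction G S] (T : Subgroup G) :
    T.relIndex (Subgroup.normalizer (T : Set G)) ∣ stabCount S T := by
  set N := Subgroup.normalizer (T : Set G) with hN
  let X : SubMulAction N S :=
    { carrier := {s | MulAction.stabilizer G s = T}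
      smul_mem' := by
        intro n s hs
        have hs : MulAction.stabilizer G s = T := hs
        change MulAction.stabilizer G ((n : G) • s) = T
        rw [MulAction.stabilizer_smul_eq_stabilizer_map_conj, hs]
        exact (map_conj_eq_iff_mem_normalizer T n).2 n.2 }
  have hX : stabCount S T = Nat.card X := rfl
  have hst : ∀ x : X, MulAction.stabilizer N x = T.subgroupOf N := by
    intro x
    ext n
    rw [MulAction.mem_stabilizer_iff, Subgroup.mem_subgroupOf, ← (x.2 : _ = T),
      MulAction.mem_stabilizer_iff, Subtype.ext_iff]
    rfl
  rw [hX, Nat.card_congr (MulAction.selfEquivSigmaOrbitsQuotientStabilizer N X)]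
  have hfin : Finite (MulAction.orbitRel.Quotient N X) := Quotient.finite _
  have := Fintype.ofFinite (MulAction.orbitRel.Quotient N X)
  by_cases h0 : Finite (N ⧸ T.subgroupOf N)
  · have : ∀ ω : MulAction.orbitRel.Quotient N X, Finite (N ⧸ MulAction.stabilizer N ω.out) := by
      intro ω
      rw [hst]; exact h0
    rw [Nat.card_sigma]
    refine Finset.dvd_sum fun ω _ => ?_
    rw [hst]
    exact dvd_rfl
  · have : IsEmpty (MulAction.orbitRel.Quotient N X) := by
      refine ⟨fun ω => h0 ?_⟩
      rw [← hst ω.out]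
      exact Finite.of_equiv _ (MulAction.orbitEquivQuotientStabilizer N ω.out)
    simp

theorem stabCount_map_conj (S : Type*) [MulAction G S] (T : Subgroup G) (g : G) :
    stabCount S (T.map (MulAut.conj g).toMonoidHom) = stabCount S T := by
  refine (Nat.card_congr ((MulAction.toPerm g).subtypeEquiv fun s => ?_)).symm
  rw [MulAction.toPerm_apply, MulAction.stabilizer_smul_eq_stabilizer_map_conj]
  exact (Subgroup.map_injective (MulAut.conj g).injective).eq_iff.symm

theorem stabilizer_quotient_mk (T : Subgroup G) (g : G) :
    MulAction.stabilizer G (g : G ⧸ T) = T.map (MulAut.conj g).toMonoidHom := by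
  have : (g : G ⧸ T) = g • ((1 : G) : G ⧸ T) := by simp
  rw [this, MulAction.stabilizer_smul_eq_stabilizer_map_conj, MulAction.stabilizer_quotient]

theorem stabCount_quotient_self (T : Subgroup G) :
    stabCount (G ⧸ T) T = T.relIndex (Subgroup.normalizer (T : Set G)) := by
  set N := Subgroup.normalizer (T : Set G) with hN
  have h0 : ∀ n : N, n • ((1 : G) : G ⧸ T) = ((n : G) : G ⧸ T) := by
    intro n
    change (((n : G) * 1 : G) : G ⧸ T) = _
    rw [mul_one]
  have h1 : {s : G ⧸ T | MulAction.stabilizer G s = T} = MulAction.orbit N ((1 : G) : G ⧸ T) := by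
    ext s
    obtain ⟨g, rfl⟩ := QuotientGroup.mk_surjective s
    rw [Set.mem_ofPred_eq, stabilizer_quotient_mk, map_conj_eq_iff_mem_normalizer]
    constructor
    · intro hg
      exact ⟨⟨g, hg⟩, h0 _⟩
    · rintro ⟨n, hn⟩
      have hn : n • ((1 : G) : G ⧸ T) = g := hn
      rw [h0] at hn
      have := QuotientGroup.eq.1 hn
      have h2 : g = n * ((n : G)⁻¹ * g) := by group
      rw [h2]
      exact N.mul_mem n.2 (Subgroup.le_normalizer this)
  have h2 : MulAction.stabilizer N ((1 : G) : G ⧸ T) = T.subgroupOf N := by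
    ext n
    rw [MulAction.mem_stabilizer_iff, Subgroup.mem_subgroupOf, h0, eq_comm, QuotientGroup.eq]
    simp
  change Nat.card {s : G ⧸ T | MulAction.stabilizer G s = T} = Nat.card (N ⧸ T.subgroupOf N)
  rw [h1, ← h2]
  exact Nat.card_congr (MulAction.orbitEquivQuotientStabilizer N _)

theorem stabCount_quotient_of_not_conj {T T' : Subgroup G}
    (h : ¬ ∃ g : G, T' = T.map (MulAut.conj g).toMonoidHom) : stabCount (G ⧸ T) T' = 0 := by
  have : IsEmpty {s : G ⧸ T // MulAction.stabilizer G s = T'} := by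
    refine ⟨fun ⟨s, hs⟩ => h ?_⟩
    obtain ⟨g, rfl⟩ := QuotientGroup.mk_surjective s
    exact ⟨g, by rw [← hs, stabilizer_quotient_mk]⟩
  exact Nat.card_of_isEmpty

end PermutationCharacters

/-! ### The Bertin obstruction in terms of Möbius sums -/

section BertinCriterion

attribute [local instance] subgroupFintype

/-- Conjugacy of subgroups, as an equivalence relation. -/
def conjSetoid (G : Type*) [Group G] : Setoid (Subgroup G) where
  r A B := ∃ g : G, B = A.map (MulAut.conj g).toMonoidHom
  iseqv :=
    { refl := fun A => ⟨1, by
        rw [map_one]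
        exact (Subgroup.map_id A).symm⟩
      symm := by
        rintro A _ ⟨g, rfl⟩
        refine ⟨g⁻¹, ?_⟩
        rw [Subgroup.map_map]
        convert (Subgroup.map_id A).symm
        ext x
        simp [mul_assoc]
      trans := by
        rintro A _ _ ⟨g, rfl⟩ ⟨h, rfl⟩
        refine ⟨h * g, ?_⟩
        rw [Subgroup.map_map]
        congr 1
        ext x
        simp [mul_assoc] }

variable {G : Type*} [Group G]

theorem isCyclic_map_conj {T : Subgroup G} (hT : IsCyclic T) (g : G) :
    IsCyclic (T.map (MulAut.conj g).toMonoidHom) :=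
  isCyclic_of_surjective _ (T.equivMapOfInjective _ (MulAut.conj g).injective).surjective

theorem exists_isCyclicRepresentatives [Finite G] {T : Subgroup G} (hT : IsCyclic T) :
    ∃ 𝒞 : Finset (Subgroup G), IsCyclicRepresentatives 𝒞 ∧ T ∈ 𝒞 := by
  classical
  let s := conjSetoid G
  let r : Subgroup G → Subgroup G := fun K => if s.r T K then T else (Quotient.mk s K).out
  have hr : ∀ K, s.r K (r K) := by
    intro K
    by_cases h : s.r T K
    · simp only [r, if_pos h]; exact s.symm h
    · simp only [r, if_neg h]; exact s.symm (Quotient.mk_out (s := s) K)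
  have hrc : ∀ K K', s.r K K' → r K = r K' := by
    intro K K' h
    have h1 : s.r T K ↔ s.r T K' := ⟨fun h' => s.trans h' h, fun h' => s.trans h' (s.symm h)⟩
    have h2 : Quotient.mk s K = Quotient.mk s K' := Quotient.sound h
    simp only [r, h1, h2]
  refine ⟨Finset.univ.filter fun K => IsCyclic K ∧ r K = K, ⟨?_, ?_⟩, ?_⟩
  · intro K hK
    simp only [Finset.mem_filter, Finset.mem_univ, true_and] at hK
    exact hK.1
  · intro K hK
    refine ⟨r K, ⟨?_, hr K⟩, ?_⟩
    · simp only [Finset.mem_filter, Finset.mem_univ, true_and]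
      refine ⟨?_, (hrc _ _ (hr K)).symm⟩
      obtain ⟨g, hg⟩ := hr K
      rw [hg]
      exact isCyclic_map_conj hK g
    · rintro K' ⟨hK', hg⟩
      simp only [Finset.mem_filter, Finset.mem_univ, true_and] at hK'
      rw [← hK'.2]
      exact (hrc _ _ hg).symm
  · simp only [Finset.mem_filter, Finset.mem_univ, true_and]
    exact ⟨hT, by simp only [r, if_pos (s.refl T)]⟩

open scoped Classical in
theorem sum_inducedTrivial_eq {R : Type*} [CommRing R] [Finite G] {𝒞 : Finset (Subgroup G)}
    (h𝒞 : ∀ T ∈ 𝒞, IsCyclic T) (b : Subgroup G → R) (g : G) :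
    ∑ T ∈ 𝒞, b T * (inducedTrivial T g : R) =
      ∑ K : Subgroup G with Subgroup.zpowers g ≤ K ∧ IsCyclic K,
        ∑ T ∈ 𝒞, b T * (stabCount (G ⧸ T) K : R) := by
  rw [Finset.sum_comm]
  refine Finset.sum_congr rfl fun T hT => ?_
  rw [← Finset.mul_sum, inducedTrivial, permCharacter_eq_sum_stabCount, ← Nat.cast_sum]
  congr 2
  symm
  refine Finset.sum_subset ?_ ?_
  · intro K
    simp only [Finset.mem_filter, Finset.mem_univ, true_and, Subgroup.zpowers_le]
    exact fun h => h.1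
  · intro K
    simp only [Finset.mem_filter, Finset.mem_univ, true_and, Subgroup.zpowers_le]
    intro h1 h2
    refine stabCount_quotient_of_not_conj ?_
    rintro ⟨x, rfl⟩
    exact h2 ⟨h1, isCyclic_map_conj (h𝒞 T hT) x⟩

theorem sum_stabCount_eq {R : Type*} [CommRing R] {𝒞 : Finset (Subgroup G)}
    (h𝒞 : IsCyclicRepresentatives 𝒞) (b : Subgroup G → R) {T : Subgroup G} (hT : T ∈ 𝒞) (g : G) :
    ∑ T' ∈ 𝒞, b T' * (stabCount (G ⧸ T') (T.map (MulAut.conj g).toMonoidHom) : R) =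
      b T * (T.relIndex (Subgroup.normalizer (T : Set G)) : R) := by
  rw [Finset.sum_eq_single T, stabCount_map_conj, stabCount_quotient_self]
  · intro T' hT' hne
    rw [stabCount_map_conj, stabCount_quotient_of_not_conj, Nat.cast_zero, mul_zero]
    rintro ⟨x, hx⟩
    obtain ⟨_, _, h⟩ := h𝒞.2 T' (h𝒞.1 T' hT')
    exact hne ((h T' ⟨hT', (conjSetoid G).refl T'⟩).trans (h T ⟨hT, x, hx⟩).symm)
  · exact fun h => (h hT).elim

open scoped Classical in
theorem moebiusSum_map_conj {R : Type*} [CommRing R] [Finite G] {F : Subgroup G → R}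
    (hF : ∀ (T : Subgroup G) (g : G), F (T.map (MulAut.conj g).toMonoidHom) = F T)
    (T : Subgroup G) (g : G) :
    moebiusSum F (T.map (MulAut.conj g).toMonoidHom) = moebiusSum F T := by
  unfold moebiusSum
  symm
  refine Finset.sum_equiv (MulAut.conj g).mapSubgroup.toEquiv ?_ ?_
  · intro Γ
    have h1 : IsCyclic Γ ↔ IsCyclic (Γ.map (MulAut.conj g).toMonoidHom) := by
      exact (Γ.equivMapOfInjective _ (MulAut.conj g).injective).isCyclic
    simp only [Finset.mem_filter, Finset.mem_univ, true_and]
    change T ≤ Γ ∧ IsCyclic Γ ↔ T.map (MulAut.conj g).toMonoidHom ≤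
      Γ.map (MulAut.conj g).toMonoidHom ∧ IsCyclic (Γ.map (MulAut.conj g).toMonoidHom)
    rw [← h1, Subgroup.map_le_map_iff_of_injective (MulAut.conj g).injective]
  · intro Γ _
    change _ = (ArithmeticFunction.moebius ((T.map (MulAut.conj g).toMonoidHom).relIndex
      (Γ.map (MulAut.conj g).toMonoidHom)) : R) * F (Γ.map (MulAut.conj g).toMonoidHom)
    rw [hF, Subgroup.relIndex_map_map_of_injective _ _ (MulAut.conj g).injective]

theorem exists_zpowers_eq {T : Subgroup G} (hT : IsCyclic T) : ∃ g, Subgroup.zpowers g = T :=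
  (Subgroup.isCyclic_iff_exists_zpowers_eq_top T).1 hT

/-- All stabilizers of the `G`-set `S` are cyclic and non-trivial, and each `g ≠ 1` has exactly
`F ⟨g⟩` fixed points. -/
def IsBertinSet (F : Subgroup G → ℤ) (S : Type*) [MulAction G S] : Prop :=
  (∀ s : S, MulAction.stabilizer G s ≠ ⊥ ∧ IsCyclic (MulAction.stabilizer G s)) ∧
    ∀ g : G, g ≠ 1 → (permCharacter S g : ℤ) = F (Subgroup.zpowers g)

open scoped Classical in
theorem IsBertinSet.moebiusSum_eq [Finite G] {F : Subgroup G → ℤ} {S : Type*} [Finite S]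
    [MulAction G S] (hS : IsBertinSet F S) {T : Subgroup G} (hT : T ≠ ⊥) (hTc : IsCyclic T) :
    moebiusSum F T = stabCount S T := by
  refine moebiusSum_eq_of_forall_eq_sum (β := fun T => (stabCount S T : ℤ)) hTc ?_
  intro Γ hΓ hTΓ
  obtain ⟨g, rfl⟩ := exists_zpowers_eq hΓ
  have hg : g ≠ 1 := by
    rintro rfl
    simp only [Subgroup.zpowers_one_eq_bot, le_bot_iff] at hTΓ
    exact hT hTΓ
  rw [← hS.2 g hg, permCharacter_eq_sum_stabCount, Nat.cast_sum]
  symm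
  refine Finset.sum_subset ?_ ?_
  · intro K
    simp only [Finset.mem_filter, Finset.mem_univ, true_and, Subgroup.zpowers_le]
    exact fun h => h.1
  · intro K
    simp only [Finset.mem_filter, Finset.mem_univ, true_and, Subgroup.zpowers_le]
    intro h1 h2
    have : IsEmpty {s : S // MulAction.stabilizer G s = K} :=
      ⟨fun ⟨s, hs⟩ => h2 ⟨h1, hs ▸ (hS.1 s).2⟩⟩
    rw [stabCount, Nat.card_of_isEmpty, Nat.cast_zero]

theorem permCharacter_sigma [Finite G] {ι : Type*} [Fintype ι] (T : ι → Subgroup G) (g : G) :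
    permCharacter (Σ i, G ⧸ T i) g = ∑ i, inducedTrivial (T i) g := by
  unfold permCharacter inducedTrivial permCharacter
  rw [← Nat.card_sigma]
  exact Nat.card_congr
    { toFun := fun x => ⟨x.1.1, x.1.2, by
        obtain ⟨⟨i, y⟩, hx⟩ := x
        have : (⟨i, g • y⟩ : Σ i, G ⧸ T i) = ⟨i, y⟩ := hx
        simpa using this⟩
      invFun := fun x => ⟨⟨x.1, x.2.1⟩, by
        obtain ⟨i, y, hy⟩ := x
        have hy : g • y = y := hy
        change (⟨i, g • y⟩ : Σ i, G ⧸ T i) = ⟨i, y⟩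
        rw [hy]⟩
      left_inv := fun _ => rfl
      right_inv := fun _ => rfl }

theorem exists_isBertinSet_of_finite [Finite G] {F : Subgroup G → ℤ} {S : Type*} [Finite S]
    [MulAction G S] (hS : IsBertinSet F S) :
    ∃ (S : Type) (_ : Finite S) (_ : MulAction G S), IsBertinSet F S := by
  obtain ⟨n, ⟨e⟩⟩ := Finite.exists_equiv_fin S
  refine ⟨Fin n, inferInstance, e.symm.mulAction G, ?_⟩
  let _ := e.symm.mulAction G
  have hsm : ∀ (g : G) (s : S), e (g • s) = g • e s := by
    intro g s
    change _ = e (g • e.symm (e s))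
    rw [Equiv.symm_apply_apply]
  have hst : ∀ s : S, MulAction.stabilizer G (e s) = MulAction.stabilizer G s := by
    intro s
    ext g
    rw [MulAction.mem_stabilizer_iff, MulAction.mem_stabilizer_iff, ← hsm, e.apply_eq_iff_eq]
  refine ⟨fun s => ?_, fun g hg => ?_⟩
  · obtain ⟨s, rfl⟩ := e.surjective s
    rw [hst]
    exact hS.1 s
  · rw [← hS.2 g hg]
    congr 1
    refine (Nat.card_congr (e.subtypeEquiv fun s => ?_)).symm
    rw [MulAction.mem_fixedBy, MulAction.mem_fixedBy, ← hsm, e.apply_eq_iff_eq]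

open scoped Classical in
/-- A class function on the cyclic subgroups is, away from the trivial subgroup, the character of a
`G`-set with non-trivial cyclic stabilizers if and only if its Möbius transform at every `T` is a
natural number divisible by `[N(T) : T]`. -/
theorem exists_isBertinSet_iff [Finite G] {F : Subgroup G → ℤ}
    (hF : ∀ (T : Subgroup G) (g : G), F (T.map (MulAut.conj g).toMonoidHom) = F T) :
    (∃ (S : Type) (_ : Finite S) (_ : MulAction G S), IsBertinSet F S) ↔
      ∀ T : Subgroup G, T ≠ ⊥ → IsCyclic T → 0 ≤ moebiusSum F T ∧
        (T.relIndex (Subgroup.normalizer (T : Set G)) : ℤ) ∣ moebiusSum F T := by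
  constructor
  · rintro ⟨S, _, _, hS⟩ T hT hTc
    rw [hS.moebiusSum_eq hT hTc]
    exact ⟨Int.natCast_nonneg _, Int.natCast_dvd_natCast.2 (relIndex_normalizer_dvd_stabCount S T)⟩
  · intro h
    -- `β T` is the number of points that shall have stabilizer `T`; no point has trivial stabilizer
    obtain ⟨𝒞, h𝒞, -⟩ := exists_isCyclicRepresentatives (G := G) (T := ⊥) inferInstance
    set β : Subgroup G → ℤ := fun T => if T = ⊥ then 0 else moebiusSum F T with hβ
    have hβc : ∀ (T : Subgroup G) (g : G), β (T.map (MulAut.conj g).toMonoidHom) = β T := by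
      intro T g
      have h0 : T.map (MulAut.conj g).toMonoidHom = ⊥ ↔ T = ⊥ :=
        Subgroup.map_eq_bot_iff_of_injective T (MulAut.conj g).injective
      simp only [hβ, moebiusSum_map_conj hF, h0]
    have hm : ∀ T : Subgroup G, ∃ m : ℕ, IsCyclic T →
        (m : ℤ) * (T.relIndex (Subgroup.normalizer (T : Set G)) : ℤ) = β T := by
      intro T
      by_cases hTc : IsCyclic T
      · by_cases hT : T = ⊥
        · exact ⟨0, fun _ => by simp [hβ, hT]⟩
        · obtain ⟨h1, c, hc⟩ := h T hT hTc
          have hpos : 0 < (T.relIndex (Subgroup.normalizer (T : Set G)) : ℤ) :=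
            Int.natCast_pos.2 (Nat.pos_of_ne_zero (relIndex_ne_zero_of_finite _ _))
          have hc0 : 0 ≤ c := by
            rw [hc] at h1
            exact nonneg_of_mul_nonneg_right h1 hpos
          refine ⟨c.toNat, fun _ => ?_⟩
          rw [Int.toNat_of_nonneg hc0, mul_comm, ← hc]
          simp [hβ, hT]
      · exact ⟨0, fun h => (hTc h).elim⟩
    choose m hm using hm
    have hm0 : m ⊥ = 0 := by
      have := hm ⊥ inferInstance
      simp only [hβ, if_true, mul_eq_zero, Int.natCast_eq_zero] at this
      exact this.resolve_right (relIndex_ne_zero_of_finite _ _)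
    let ι := Σ T : 𝒞, Fin (m T)
    refine exists_isBertinSet_of_finite (S := Σ i : ι, G ⧸ (i.1 : Subgroup G)) ⟨?_, ?_⟩
    · rintro ⟨⟨T, j⟩, x⟩
      obtain ⟨x, rfl⟩ := QuotientGroup.mk_surjective x
      have hst : MulAction.stabilizer G
          (⟨⟨T, j⟩, (x : G ⧸ (T : Subgroup G))⟩ : Σ i : ι, G ⧸ (i.1 : Subgroup G)) =
          (T : Subgroup G).map (MulAut.conj x).toMonoidHom := by
        rw [← stabilizer_quotient_mk]
        ext g
        rw [MulAction.mem_stabilizer_iff, MulAction.mem_stabilizer_iff, Sigma.smul_mk]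
        simp
      rw [hst]
      refine ⟨?_, isCyclic_map_conj (h𝒞.1 T T.2) x⟩
      rw [Ne, Subgroup.map_eq_bot_iff_of_injective _ (MulAut.conj x).injective]
      intro h0
      exact absurd j.2 (by simp [h0, hm0])
    · intro g hg
      have h1 : (permCharacter (Σ i : ι, G ⧸ (i.1 : Subgroup G)) g : ℤ) =
          ∑ T ∈ 𝒞, (m T : ℤ) * (inducedTrivial T g : ℤ) := by
        rw [permCharacter_sigma (fun i : ι => (i.1 : Subgroup G)), Fintype.sum_sigma,
          Nat.cast_sum, ← Finset.sum_coe_sort 𝒞]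
        simp
      rw [h1, sum_inducedTrivial_eq h𝒞.1 (fun T => (m T : ℤ)),
        ← sum_moebiusSum F (T := Subgroup.zpowers g) inferInstance]
      refine Finset.sum_congr rfl fun K hK => ?_
      simp only [Finset.mem_filter, Finset.mem_univ, true_and] at hK
      obtain ⟨T, ⟨hT, x, hx⟩, -⟩ := h𝒞.2 K hK.2
      obtain ⟨y, hy⟩ := (conjSetoid G).symm ⟨x, hx⟩
      rw [hy, sum_stabCount_eq h𝒞 (fun T => (m T : ℤ)) hT, hm T (h𝒞.1 T hT),
        ← hβc T y, ← hy]
      have : K ≠ ⊥ := by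
        rintro rfl
        exact hg (Subgroup.zpowers_eq_bot.1 (le_bot_iff.1 hK.1))
      simp [hβ, this]

open scoped Classical in
/-- The coefficient of `1_T^G` in the expansion of `-a_φ`. Existence of an expansion over the rational
numbers is part of the proof, since `bertinConstant` would otherwise be a junk value. -/
theorem relIndex_mul_bertinConstant [Finite G] {k : Type*} [Field k]
    (φ : G →* (k⟦X⟧ ≃ₐ[k] k⟦X⟧)) {F : Subgroup G → ℤ}
    (hF : ∀ (T : Subgroup G) (g : G), F (T.map (MulAut.conj g).toMonoidHom) = F T)
    (hFφ : ∀ g : G, F (Subgroup.zpowers g) = -artinCharacter φ g)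
    {T : Subgroup G} (hT : IsCyclic T) :
    (T.relIndex (Subgroup.normalizer (T : Set G)) : ℚ) * bertinConstant φ T =
      ((moebiusSum F T : ℤ) : ℚ) := by
  have hN : ∀ T : Subgroup G, (T.relIndex (Subgroup.normalizer (T : Set G)) : ℚ) ≠ 0 :=
    fun T => Nat.cast_ne_zero.2 (relIndex_ne_zero_of_finite _ _)
  have hcast : ∀ T : Subgroup G,
      ((moebiusSum F T : ℤ) : ℚ) = moebiusSum (fun Γ => (F Γ : ℚ)) T := by
    intro T
    simp [moebiusSum]
  have hex : ∃ q, IsBertinConstant φ T q := by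
    obtain ⟨𝒞, h𝒞, hT𝒞⟩ := exists_isCyclicRepresentatives hT
    refine ⟨_, 𝒞, fun T => ((moebiusSum F T : ℤ) : ℚ) /
      (T.relIndex (Subgroup.normalizer (T : Set G)) : ℚ), h𝒞, hT𝒞, rfl, fun g => ?_⟩
    have hinv := sum_moebiusSum F (T := Subgroup.zpowers g) inferInstance
    rw [sum_inducedTrivial_eq h𝒞.1, ← Int.cast_neg, ← hFφ, ← hinv, Int.cast_sum]
    refine Finset.sum_congr rfl fun K hK => ?_
    simp only [Finset.mem_filter, Finset.mem_univ, true_and] at hK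
    obtain ⟨T, ⟨hT, x, hx⟩, -⟩ := h𝒞.2 K hK.2
    obtain ⟨y, hy⟩ := (conjSetoid G).symm ⟨x, hx⟩
    rw [hy, sum_stabCount_eq h𝒞 _ hT, moebiusSum_map_conj hF, div_mul_cancel₀ _ (hN T)]
  obtain ⟨𝒞, b, h𝒞, hT𝒞, hb, hexp⟩ := Classical.epsilon_spec hex
  have hb : b T = bertinConstant φ T := hb
  have h1 := sum_stabCount_eq h𝒞 b hT𝒞 1
  have h2 : T.map (MulAut.conj (1 : G)).toMonoidHom = T := by
    rw [map_one]
    exact Subgroup.map_id T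
  rw [h2] at h1
  rw [← hb, mul_comm, ← h1, hcast]
  refine (moebiusSum_eq_of_forall_eq_sum
    (β := fun K => ∑ T' ∈ 𝒞, b T' * (stabCount (G ⧸ T') K : ℚ)) hT fun Γ hΓ _ => ?_).symm
  obtain ⟨g, rfl⟩ := exists_zpowers_eq hΓ
  rw [← sum_inducedTrivial_eq h𝒞.1, ← hexp, hFφ, Int.cast_neg]

end BertinCriterion

/-! ### Automorphisms of `k⟦X⟧` and the ramification filtration -/

section PowerSeriesAutomorphisms

variable {k : Type*} [Field k]

theorem constantCoeff_algEquiv (σ : k⟦X⟧ ≃ₐ[k] k⟦X⟧) (f : k⟦X⟧) :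
    constantCoeff (σ f) = constantCoeff f := by
  have h1 : ¬ IsUnit (f - algebraMap k k⟦X⟧ (constantCoeff f)) := by
    rw [PowerSeries.isUnit_iff_constantCoeff]
    simp
  have h2 : ¬ IsUnit (σ (f - algebraMap k k⟦X⟧ (constantCoeff f))) := by
    rwa [MulEquiv.isUnit_map]
  rw [PowerSeries.isUnit_iff_constantCoeff, isUnit_iff_ne_zero, not_not, map_sub,
    AlgEquiv.commutes] at h2
  simpa [PowerSeries.algebraMap_apply, sub_eq_zero] using h2

/-- The coefficient of `X` in `σ X`: the action of `σ` on the tangent space. -/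
def tangentCoeff (σ : k⟦X⟧ ≃ₐ[k] k⟦X⟧) : k := coeff 1 (σ X)

theorem exists_algEquiv_X_eq (σ : k⟦X⟧ ≃ₐ[k] k⟦X⟧) :
    ∃ w : k⟦X⟧, σ X = X * w ∧ constantCoeff w = tangentCoeff σ := by
  obtain ⟨w, hw⟩ : (X : k⟦X⟧) ∣ σ X := by
    rw [PowerSeries.X_dvd_iff, constantCoeff_algEquiv]
    simp
  refine ⟨w, hw, ?_⟩
  rw [tangentCoeff, hw]
  simp

theorem X_pow_dvd_algEquiv (σ : k⟦X⟧ ≃ₐ[k] k⟦X⟧) {n : ℕ} {f : k⟦X⟧} (h : X ^ n ∣ f) :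
    X ^ n ∣ σ f := by
  obtain ⟨g, rfl⟩ := h
  obtain ⟨w, hw, -⟩ := exists_algEquiv_X_eq σ
  rw [map_mul, map_pow, hw, mul_pow, mul_assoc]
  exact dvd_mul_right _ _

theorem coeff_X_pow_mul_self (n : ℕ) (f : k⟦X⟧) : coeff n (X ^ n * f) = constantCoeff f := by
  simpa using PowerSeries.coeff_X_pow_mul f n 0

/-- On `X ^ n k⟦X⟧ / X ^ (n + 1) k⟦X⟧`, `σ` acts by the `n`-th power of its tangent coefficient. -/
theorem coeff_algEquiv (σ : k⟦X⟧ ≃ₐ[k] k⟦X⟧) {n : ℕ} {f : k⟦X⟧} (h : X ^ n ∣ f) :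
    coeff n (σ f) = tangentCoeff σ ^ n * coeff n f := by
  obtain ⟨g, rfl⟩ := h
  obtain ⟨w, hw, hw'⟩ := exists_algEquiv_X_eq σ
  rw [map_mul, map_pow, hw, mul_pow, mul_assoc, coeff_X_pow_mul_self, coeff_X_pow_mul_self,
    map_mul, map_pow, hw', constantCoeff_algEquiv]

/-- The character by which automorphisms of `k⟦X⟧` act on the tangent space. -/
def tangentCharacter (k : Type*) [Field k] : (k⟦X⟧ ≃ₐ[k] k⟦X⟧) →* kˣ :=
  MonoidHom.toHomUnits
    { toFun := tangentCoeff
      map_one' := by simp [tangentCoeff]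
      map_mul' := fun σ τ => by
        have h : (X : k⟦X⟧) ^ 1 ∣ τ X := X_pow_dvd_algEquiv τ (by simp)
        have := coeff_algEquiv σ h
        rw [pow_one] at this
        exact this }

theorem coe_tangentCharacter (σ : k⟦X⟧ ≃ₐ[k] k⟦X⟧) :
    (tangentCharacter k σ : k) = tangentCoeff σ := rfl

/-- A power series differs from its constant coefficient by a multiple of `X`, so that
`σ f - f` is governed by `σ X - X`. -/
theorem exists_algEquiv_sub_eq (f : k⟦X⟧) : ∃ g : k⟦X⟧, constantCoeff g = coeff 1 f ∧
    ∀ σ : k⟦X⟧ ≃ₐ[k] k⟦X⟧, σ f - f = (σ X - X) * σ g + X * (σ g - g) := by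
  obtain ⟨g, hg⟩ : (X : k⟦X⟧) ∣ f - algebraMap k k⟦X⟧ (constantCoeff f) := by
    rw [PowerSeries.X_dvd_iff]
    simp
  have hf : f = algebraMap k k⟦X⟧ (constantCoeff f) + X * g := by rw [← hg]; ring
  refine ⟨g, ?_, fun σ => ?_⟩
  · have := congrArg (coeff 1) hf
    rw [map_add, PowerSeries.algebraMap_apply, PowerSeries.coeff_succ_X_mul 0 g] at this
    simpa using this.symm
  · have h1 : σ f = algebraMap k k⟦X⟧ (constantCoeff f) + σ X * σ g := by
      conv_lhs => rw [hf]
      rw [map_add, map_mul, AlgEquiv.commutes]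
    have h2 : σ f - f = (algebraMap k k⟦X⟧ (constantCoeff f) + σ X * σ g) -
        (algebraMap k k⟦X⟧ (constantCoeff f) + X * g) := by rw [h1, ← hf]
    rw [h2]
    ring

theorem X_pow_dvd_algEquiv_sub {σ : k⟦X⟧ ≃ₐ[k] k⟦X⟧} {N : ℕ} (h : X ^ N ∣ σ X - X)
    (f : k⟦X⟧) : X ^ N ∣ σ f - f := by
  have key : ∀ n ≤ N, ∀ f : k⟦X⟧, X ^ n ∣ σ f - f := by
    intro n
    induction n with
    | zero => intro _ f; simp
    | succ n ih =>
      intro hn f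
      obtain ⟨g, -, hg⟩ := exists_algEquiv_sub_eq f
      rw [hg σ, pow_succ']
      refine dvd_add (Dvd.dvd.mul_right ?_ _) (mul_dvd_mul_left X (ih (by omega) g))
      rw [← pow_succ']
      exact (pow_dvd_pow X hn).trans h
  exact key N le_rfl f

theorem coeff_algEquiv_sub {σ : k⟦X⟧ ≃ₐ[k] k⟦X⟧} {N : ℕ} (h : X ^ N ∣ σ X - X)
    (f : k⟦X⟧) : coeff N (σ f - f) = coeff N (σ X - X) * coeff 1 f := by
  obtain ⟨g, hg1, hg⟩ := exists_algEquiv_sub_eq f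
  obtain ⟨a, ha⟩ := h
  obtain ⟨b, hb⟩ := X_pow_dvd_algEquiv_sub ⟨a, ha⟩ g
  have h2 : σ f - f = X ^ N * (a * σ g + X * b) := by rw [hg σ, ha, hb]; ring
  rw [h2, ha, coeff_X_pow_mul_self, coeff_X_pow_mul_self]
  simp [constantCoeff_algEquiv, hg1]

/-- Automorphisms of `k⟦X⟧` are automatically continuous, so they are determined by the image of
`X`. -/
theorem eq_one_of_algEquiv_X {σ : k⟦X⟧ ≃ₐ[k] k⟦X⟧} (h : σ X = X) : σ = 1 := by
  ext f n
  have h1 : (X : k⟦X⟧) ^ (n + 1) ∣ σ f - f :=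
    X_pow_dvd_algEquiv_sub (by rw [h, sub_self]; exact dvd_zero _) f
  have := (PowerSeries.X_pow_dvd_iff.1 h1) n (Nat.lt_succ_self n)
  rw [map_sub, sub_eq_zero] at this
  exact this

end PowerSeriesAutomorphisms

section Ramification

variable {k : Type*} [Field k] {G : Type*} [Group G] (φ : G →* (k⟦X⟧ ≃ₐ[k] k⟦X⟧))

/-- The ramification groups: the `g` with `φ(g)(X) ≡ X` modulo `X ^ n`. -/
def ramificationSubgroup (n : ℕ) : Subgroup G where
  carrier := {g | X ^ n ∣ φ g X - X}
  one_mem' := by simp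
  mul_mem' := by
    intro a b ha hb
    have ha : X ^ n ∣ φ a X - X := ha
    have hb : X ^ n ∣ φ b X - X := hb
    have : φ (a * b) X - X = φ a (φ b X - X) + (φ a X - X) := by
      rw [map_mul, AlgEquiv.mul_apply, map_sub]
      ring
    change X ^ n ∣ φ (a * b) X - X
    rw [this]
    exact dvd_add (X_pow_dvd_algEquiv _ hb) ha
  inv_mem' := by
    intro a ha
    have ha : X ^ n ∣ φ a X - X := ha
    have h1 : φ a⁻¹ (φ a X) = X := by
      rw [← AlgEquiv.mul_apply, ← map_mul]
      simp
    have : φ a⁻¹ X - X = - φ a⁻¹ (φ a X - X) := by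
      rw [map_sub, h1]
      ring
    change X ^ n ∣ φ a⁻¹ X - X
    rw [this]
    exact (X_pow_dvd_algEquiv _ ha).neg_right

variable {φ}

theorem mem_ramificationSubgroup {n : ℕ} {g : G} :
    g ∈ ramificationSubgroup φ n ↔ X ^ n ∣ φ g X - X := Iff.rfl

theorem conj_apply_X_sub (x g : G) :
    φ (x * g * x⁻¹) X - X = φ x (φ g (φ x⁻¹ X) - φ x⁻¹ X) := by
  have h1 : φ x (φ x⁻¹ X) = X := by
    rw [← AlgEquiv.mul_apply, ← map_mul]
    simp
  rw [map_sub, h1, map_mul, map_mul, AlgEquiv.mul_apply, AlgEquiv.mul_apply]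

instance ramificationSubgroup_normal (n : ℕ) : (ramificationSubgroup φ n).Normal where
  conj_mem g hg x := by
    rw [mem_ramificationSubgroup, conj_apply_X_sub]
    exact X_pow_dvd_algEquiv _ (X_pow_dvd_algEquiv_sub hg _)

/-- The leading coefficient of `g` is multiplied by `θ₀(x) ^ (n - 1)` under conjugation by `x`. -/
theorem coeff_conj_apply_X_sub {n : ℕ} {g : G} (hg : g ∈ ramificationSubgroup φ n) (x : G) :
    coeff n (φ (x * g * x⁻¹) X - X) * tangentCoeff (φ x) =
      tangentCoeff (φ x) ^ n * coeff n (φ g X - X) := by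
  rw [conj_apply_X_sub, coeff_algEquiv _ (X_pow_dvd_algEquiv_sub hg _), coeff_algEquiv_sub hg]
  have h1 : coeff 1 (φ x⁻¹ X) * tangentCoeff (φ x) = 1 := by
    have h2 : tangentCharacter k (φ x⁻¹) * tangentCharacter k (φ x) = 1 := by
      rw [← map_mul, ← map_mul]
      simp
    exact congrArg Units.val h2
  rw [mul_assoc, mul_assoc, h1, mul_one]

theorem tangentCoeff_eq_one_iff (g : G) :
    tangentCoeff (φ g) = 1 ↔ g ∈ ramificationSubgroup φ 2 := by
  rw [mem_ramificationSubgroup, PowerSeries.X_pow_dvd_iff]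
  constructor
  · intro h m hm
    interval_cases m
    · simpa using constantCoeff_algEquiv (φ g) X
    · rw [map_sub, sub_eq_zero, ← tangentCoeff, h, PowerSeries.coeff_one_X]
  · intro h
    have := h 1 (by norm_num)
    rw [map_sub, sub_eq_zero, PowerSeries.coeff_one_X] at this
    exact this

theorem mem_ramificationSubgroup_one (g : G) : g ∈ ramificationSubgroup φ 1 := by
  rw [mem_ramificationSubgroup, PowerSeries.X_pow_dvd_iff]
  intro m hm
  interval_cases m
  simpa using constantCoeff_algEquiv (φ g) X

theorem coeff_mul_apply_X_sub {n : ℕ} {a b : G} (ha : a ∈ ramificationSubgroup φ 2)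
    (hb : b ∈ ramificationSubgroup φ n) :
    coeff n (φ (a * b) X - X) = coeff n (φ a X - X) + coeff n (φ b X - X) := by
  have : φ (a * b) X - X = φ a (φ b X - X) + (φ a X - X) := by
    rw [map_mul, AlgEquiv.mul_apply, map_sub]
    ring
  rw [this, map_add, coeff_algEquiv _ hb, (tangentCoeff_eq_one_iff a).2 ha, one_pow, one_mul,
    add_comm]

theorem ramificationSubgroup_anti {m n : ℕ} (h : m ≤ n) :
    ramificationSubgroup φ n ≤ ramificationSubgroup φ m :=
  fun _ hg => (pow_dvd_pow (X : k⟦X⟧) h).trans hg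

theorem coeff_pow_apply_X_sub {n : ℕ} (hn : 2 ≤ n) {g : G} (hg : g ∈ ramificationSubgroup φ n)
    (m : ℕ) : coeff n (φ (g ^ m) X - X) = (m : k) * coeff n (φ g X - X) := by
  induction m with
  | zero => simp
  | succ m ih =>
    rw [pow_succ', coeff_mul_apply_X_sub (ramificationSubgroup_anti hn hg)
      (Subgroup.pow_mem _ hg m), ih]
    push_cast
    ring

theorem apply_X_sub_ne_zero (hφ : Function.Injective φ) {g : G} (hg : g ≠ 1) : φ g X - X ≠ 0 := by
  intro h
  exact hg (hφ (by rw [eq_one_of_algEquiv_X (sub_eq_zero.1 h), map_one]))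

theorem mem_ramificationSubgroup_iff_le (hφ : Function.Injective φ) {n : ℕ} {g : G} (hg : g ≠ 1) :
    g ∈ ramificationSubgroup φ n ↔ n ≤ ramificationNumber φ g := by
  rw [mem_ramificationSubgroup, PowerSeries.X_pow_dvd_iff, ramificationNumber]
  constructor
  · intro h
    by_contra hlt
    exact PowerSeries.coeff_order (apply_X_sub_ne_zero hφ hg) (h _ (not_le.1 hlt))
  · intro h m hm
    exact PowerSeries.coeff_of_lt_order_toNat _ (hm.trans_le h)

theorem coeff_ramificationNumber_ne_zero (hφ : Function.Injective φ) {g : G} (hg : g ≠ 1) :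
    coeff (ramificationNumber φ g) (φ g X - X) ≠ 0 :=
  PowerSeries.coeff_order (apply_X_sub_ne_zero hφ hg)

theorem ramificationNumber_eq_one_iff (hφ : Function.Injective φ) {g : G} (hg : g ≠ 1) :
    ramificationNumber φ g = 1 ↔ tangentCoeff (φ g) ≠ 1 := by
  have h1 := (mem_ramificationSubgroup_iff_le hφ hg).1 (mem_ramificationSubgroup_one g)
  rw [Ne, tangentCoeff_eq_one_iff, mem_ramificationSubgroup_iff_le hφ hg]
  omega

/-- If `x g x⁻¹ = g ^ m`, comparison of leading coefficients gives `θ₀(x) ^ (i(g) - 1) = m`. -/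
theorem tangentCoeff_pow_eq (hφ : Function.Injective φ) {x g : G} (hg : g ≠ 1)
    (hg2 : g ∈ ramificationSubgroup φ 2) {m : ℕ}
    (h : x * g * x⁻¹ = g ^ m) :
    tangentCoeff (φ x) ^ (ramificationNumber φ g - 1) = (m : k) := by
  set n := ramificationNumber φ g with hn
  have hn2 : 2 ≤ n := (mem_ramificationSubgroup_iff_le hφ hg).1 hg2
  have hgn : g ∈ ramificationSubgroup φ n := (mem_ramificationSubgroup_iff_le hφ hg).2 le_rfl
  have h1 := coeff_conj_apply_X_sub hgn x
  rw [h, coeff_pow_apply_X_sub hn2 hgn] at h1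
  have ha : coeff n (φ g X - X) ≠ 0 := coeff_ramificationNumber_ne_zero hφ hg
  have ht : tangentCoeff (φ x) ≠ 0 := (tangentCharacter k (φ x)).ne_zero
  have h2 : tangentCoeff (φ x) ^ n = tangentCoeff (φ x) ^ (n - 1) * tangentCoeff (φ x) := by
    rw [← pow_succ]
    congr 1
    omega
  rw [h2] at h1
  refine (mul_right_cancel₀ (mul_ne_zero ha ht) ?_).symm
  linear_combination h1

end Ramification

/-! ### Ramification numbers of cyclic subgroups -/

section RamificationOfSubgroups

attribute [local instance] subgroupFintype

variable {k : Type*} [Field k] {G : Type*} [Group G]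

theorem subgroupOf_le_subgroupOf_iff {H K L : Subgroup G} (hK : K ≤ H) :
    K.subgroupOf H ≤ L.subgroupOf H ↔ K ≤ L :=
  ⟨fun h x hx => h (x := ⟨x, hK hx⟩) hx, fun h _ hx => h hx⟩

open scoped Classical in
/-- The value of `-a_φ` at the generators of a cyclic subgroup `Γ`. For `Γ ≠ 1` it is expressed
through the ramification groups containing `Γ`, so that no generator has to be chosen. -/
def ramificationOn (φ : G →* (k⟦X⟧ ≃ₐ[k] k⟦X⟧)) (Γ : Subgroup G) : ℤ :=
  if Γ = ⊥ then -artinCharacter φ 1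
  else (sSup {n : ℕ | Γ ≤ ramificationSubgroup φ n} : ℕ)

theorem ramificationOn_zpowers_of_ne_one {φ : G →* (k⟦X⟧ ≃ₐ[k] k⟦X⟧)}
    (hφ : Function.Injective φ) {g : G} (hg : g ≠ 1) :
    ramificationOn φ (Subgroup.zpowers g) = ramificationNumber φ g := by
  rw [ramificationOn, if_neg (by simpa using hg)]
  congr 1
  have : {n : ℕ | Subgroup.zpowers g ≤ ramificationSubgroup φ n} =
      Set.Iic (ramificationNumber φ g) := by
    ext n
    rw [Set.mem_Iic, ← mem_ramificationSubgroup_iff_le hφ hg, ← Subgroup.zpowers_le]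
    rfl
  rw [this, csSup_Iic]

theorem ramificationOn_zpowers {φ : G →* (k⟦X⟧ ≃ₐ[k] k⟦X⟧)} (hφ : Function.Injective φ) (g : G) :
    ramificationOn φ (Subgroup.zpowers g) = -artinCharacter φ g := by
  by_cases hg : g = 1
  · subst hg
    rw [ramificationOn, if_pos Subgroup.zpowers_one_eq_bot]
  · rw [ramificationOn_zpowers_of_ne_one hφ hg, artinCharacter, if_neg hg, neg_neg]

theorem ramificationOn_map_conj (φ : G →* (k⟦X⟧ ≃ₐ[k] k⟦X⟧)) (T : Subgroup G) (g : G) :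
    ramificationOn φ (T.map (MulAut.conj g).toMonoidHom) = ramificationOn φ T := by
  have h0 : T.map (MulAut.conj g).toMonoidHom = ⊥ ↔ T = ⊥ :=
    Subgroup.map_eq_bot_iff_of_injective T (MulAut.conj g).injective
  have h1 : ∀ n, T.map (MulAut.conj g).toMonoidHom ≤ ramificationSubgroup φ n ↔
      T ≤ ramificationSubgroup φ n := by
    intro n
    rw [Subgroup.map_le_iff_le_comap]
    have : (ramificationSubgroup φ n).comap (MulAut.conj g).toMonoidHom =
        ramificationSubgroup φ n := by
      ext x
      refine ⟨fun h => ?_, fun h => (ramificationSubgroup_normal n).conj_mem x h g⟩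
      have := (ramificationSubgroup_normal n).conj_mem _ h g⁻¹
      simpa [mul_assoc] using this
    rw [this]
  by_cases h : T = ⊥
  · rw [ramificationOn, ramificationOn, if_pos h, if_pos (h0.2 h)]
  · rw [ramificationOn, ramificationOn, if_neg h, if_neg (h0.not.2 h)]
    simp only [h1]

theorem ramificationOn_subgroupOf (φ : G →* (k⟦X⟧ ≃ₐ[k] k⟦X⟧)) {H Γ : Subgroup G} (hΓ : Γ ≠ ⊥)
    (hΓH : Γ ≤ H) : ramificationOn (φ.comp H.subtype) (Γ.subgroupOf H) = ramificationOn φ Γ := by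
  have h0 : Γ.subgroupOf H ≠ ⊥ := by
    rw [Ne, Subgroup.subgroupOf_eq_bot, disjoint_iff, inf_eq_left.2 hΓH]
    exact hΓ
  rw [ramificationOn, ramificationOn, if_neg h0, if_neg hΓ]
  congr 3
  ext n
  change Γ.subgroupOf H ≤ (ramificationSubgroup φ n).subgroupOf H ↔ _
  rw [subgroupOf_le_subgroupOf_iff hΓH]

theorem bertinVanishes_iff_exists_isBertinSet {φ : G →* (k⟦X⟧ ≃ₐ[k] k⟦X⟧)}
    (hφ : Function.Injective φ) : BertinVanishes φ ↔
      ∃ (S : Type) (_ : Finite S) (_ : MulAction G S), IsBertinSet (ramificationOn φ) S := by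
  simp only [BertinVanishes, IsBertinSet, ramificationOn_zpowers hφ]

/-- The Bertin obstruction in terms of Möbius sums of ramification numbers. -/
theorem bertinVanishes_iff [Finite G] {φ : G →* (k⟦X⟧ ≃ₐ[k] k⟦X⟧)} (hφ : Function.Injective φ) :
    BertinVanishes φ ↔ ∀ T : Subgroup G, T ≠ ⊥ → IsCyclic T →
      0 ≤ moebiusSum (ramificationOn φ) T ∧
      (T.relIndex (Subgroup.normalizer (T : Set G)) : ℤ) ∣ moebiusSum (ramificationOn φ) T := by
  rw [bertinVanishes_iff_exists_isBertinSet hφ,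
    exists_isBertinSet_iff (ramificationOn_map_conj φ)]

open scoped Classical in
theorem moebiusSum_subgroupOf [Finite G] {R : Type*} [CommRing R] {H T : Subgroup G} (hTH : T ≤ H)
    {F' : Subgroup H → R} {F : Subgroup G → R}
    (hF : ∀ Γ : Subgroup G, T ≤ Γ → Γ ≤ H → F' (Γ.subgroupOf H) = F Γ) :
    moebiusSum F' (T.subgroupOf H) =
      ∑ Γ : Subgroup G with (T ≤ Γ ∧ IsCyclic Γ) ∧ Γ ≤ H,
        (ArithmeticFunction.moebius (T.relIndex Γ) : R) * F Γ := by
  unfold moebiusSum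
  symm
  have hcyc : ∀ Γ : Subgroup G, Γ ≤ H → (IsCyclic Γ ↔ IsCyclic (Γ.subgroupOf H)) := fun Γ h =>
    (Subgroup.subgroupOfEquivOfLe h).isCyclic.symm
  refine Finset.sum_bij (fun Γ _ => Γ.subgroupOf H) ?_ ?_ ?_ ?_
  · intro Γ hΓ
    simp only [Finset.mem_filter, Finset.mem_univ, true_and] at hΓ ⊢
    exact ⟨(subgroupOf_le_subgroupOf_iff hTH).2 hΓ.1.1, (hcyc Γ hΓ.2).1 hΓ.1.2⟩
  · intro Γ hΓ Γ' hΓ' h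
    simp only [Finset.mem_filter, Finset.mem_univ, true_and] at hΓ hΓ'
    exact le_antisymm ((subgroupOf_le_subgroupOf_iff hΓ.2).1 h.le)
      ((subgroupOf_le_subgroupOf_iff hΓ'.2).1 h.ge)
  · intro K hK
    simp only [Finset.mem_filter, Finset.mem_univ, true_and] at hK
    have hKH : K.map H.subtype ≤ H := Subgroup.map_subtype_le K
    have hKK : (K.map H.subtype).subgroupOf H = K :=
      Subgroup.comap_map_eq_self_of_injective H.subtype_injective K
    refine ⟨K.map H.subtype, ?_, hKK⟩
    simp only [Finset.mem_filter, Finset.mem_univ, true_and]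
    refine ⟨⟨?_, ?_⟩, hKH⟩
    · rw [← subgroupOf_le_subgroupOf_iff hTH, hKK]
      exact hK.1
    · rw [hcyc _ hKH, hKK]
      exact hK.2
  · intro Γ hΓ
    simp only [Finset.mem_filter, Finset.mem_univ, true_and] at hΓ
    rw [hF Γ hΓ.1.1 hΓ.2, Subgroup.relIndex_subgroupOf hΓ.2]

theorem relIndex_normalizer_subgroupOf {H T : Subgroup G} (hTH : T ≤ H) :
    (T.subgroupOf H).relIndex (Subgroup.normalizer (T.subgroupOf H : Set H)) =
      T.relIndex (normalizerIn H T) := by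
  have h1 : Subgroup.normalizer (T.subgroupOf H : Set H) = (normalizerIn H T).subgroupOf H := by
    ext x
    rw [Subgroup.mem_subgroupOf, normalizerIn, Subgroup.mem_inf, Subgroup.mem_normalizer_iff,
      Subgroup.mem_normalizer_iff, and_iff_left x.2]
    constructor
    · intro h y
      constructor
      · intro hy
        exact (h ⟨y, hTH hy⟩).1 hy
      · intro hy
        have hyH : y ∈ H := by
          have := H.mul_mem (H.mul_mem (H.inv_mem x.2) (hTH hy)) x.2
          simpa [mul_assoc] using this
        exact (h ⟨y, hyH⟩).2 hy
    · intro h y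
      exact h y
  have h2 : normalizerIn H T ≤ H := inf_le_right
  rw [h1, Subgroup.relIndex_subgroupOf h2]

theorem injective_comp_subtype {k : Type*} [Field k] {G : Type*} [Group G]
    {φ : G →* (k⟦X⟧ ≃ₐ[k] k⟦X⟧)} (hφ : Function.Injective φ) (H : Subgroup G) :
    Function.Injective (φ.comp H.subtype) :=
  fun _ _ h => Subtype.ext (hφ h)

/-- The obstruction restricts to subgroups: restrict the `G`-set. -/
theorem BertinVanishes.restrict {k : Type*} [Field k] {G : Type*} [Group G]
    {φ : G →* (k⟦X⟧ ≃ₐ[k] k⟦X⟧)} (hφ : Function.Injective φ) (h : BertinVanishes φ)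
    (H : Subgroup G) : BertinVanishes (φ.comp H.subtype) := by
  rw [bertinVanishes_iff_exists_isBertinSet hφ] at h
  obtain ⟨S, _, _, hS⟩ := h
  have hφH := injective_comp_subtype hφ H
  rw [bertinVanishes_iff_exists_isBertinSet hφH]
  -- discard the points with trivial stabilizer in `H`
  let S' : SubMulAction H S :=
    { carrier := {s | MulAction.stabilizer H s ≠ ⊥}
      smul_mem' := by
        intro x s hs
        have hs : MulAction.stabilizer H s ≠ ⊥ := hs
        change MulAction.stabilizer H (x • s) ≠ ⊥
        rw [MulAction.stabilizer_smul_eq_stabilizer_map_conj, Ne,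
          Subgroup.map_eq_bot_iff_of_injective _ (MulAut.conj x).injective]
        exact hs }
  have hst : ∀ s : S',
      MulAction.stabilizer H s = (MulAction.stabilizer G (s : S)).subgroupOf H := by
    intro s
    ext x
    rw [MulAction.mem_stabilizer_iff, Subtype.ext_iff, Subgroup.mem_subgroupOf,
      MulAction.mem_stabilizer_iff]
    rfl
  refine ⟨S', inferInstance, inferInstance, fun s => ⟨?_, ?_⟩, fun x hx => ?_⟩
  · rw [hst]
    exact s.2
  · rw [hst]
    have := (hS.1 (s : S)).2
    exact isCyclic_of_injective
      ((H.subtype.comp ((MulAction.stabilizer G (s : S)).subgroupOf H).subtype).codRestrict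
        (MulAction.stabilizer G (s : S)) fun y => y.2)
      fun a b hab => Subtype.ext (Subtype.ext
        (congrArg (Subtype.val : MulAction.stabilizer G (s : S) → G) hab))
  · have hx' : (x : G) ≠ 1 := fun h => hx (Subtype.ext h)
    have h1 : ramificationOn (φ.comp H.subtype) (Subgroup.zpowers x) =
        ramificationOn φ (Subgroup.zpowers (x : G)) := by
      rw [ramificationOn_zpowers_of_ne_one hφH hx, ramificationOn_zpowers_of_ne_one hφ hx']
      rfl
    rw [h1, ← hS.2 x hx']
    congr 1
    refine Nat.card_congr
      { toFun := fun s => ⟨(s.1 : S), congrArg Subtype.val (s.2 : x • s.1 = s.1)⟩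
        invFun := fun s => ⟨⟨s.1, fun h0 => hx ?_⟩, Subtype.ext s.2⟩
        left_inv := fun _ => rfl
        right_inv := fun _ => rfl }
    have h2 : x ∈ MulAction.stabilizer H (s : S) := s.2
    rw [h0] at h2
    exact h2

end RamificationOfSubgroups

section WildInertia

variable {p : ℕ} [Fact p.Prime] {k : Type*} [Field k] [CharP k p] {G : Type*} [Group G]
  {φ : G →* (k⟦X⟧ ≃ₐ[k] k⟦X⟧)}

theorem eq_one_of_pow_prime_pow_eq_one {x : k} {n : ℕ} (h : x ^ p ^ n = 1) : x = 1 := by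
  have : (x - 1) ^ p ^ n = 0 := by rw [sub_pow_char_pow, h, one_pow, sub_self]
  exact sub_eq_zero.1 ((pow_eq_zero_iff (pow_pos (Fact.out : p.Prime).pos n).ne').1 this)

/-- If the `p'`-part `h` of `g` were non-trivial, of order `m`, its leading coefficient `a ≠ 0` would
satisfy `m a = 0`, because `h ^ m = 1`. -/
theorem isPGroup_ramificationSubgroup_two [Finite G] (hφ : Function.Injective φ) :
    IsPGroup p (ramificationSubgroup φ 2) := by
  intro ⟨g, hg⟩
  obtain ⟨n, m, hm, hgm⟩ := Nat.exists_eq_pow_mul_and_not_dvd (orderOf_pos g).ne' p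
    (Fact.out : p.Prime).ne_one
  refine ⟨n, Subtype.ext ?_⟩
  change g ^ p ^ n = 1
  by_contra h1
  have h2 : g ^ p ^ n ∈ ramificationSubgroup φ 2 := Subgroup.pow_mem _ hg _
  have h3 := coeff_pow_apply_X_sub ((mem_ramificationSubgroup_iff_le hφ h1).1 h2)
    ((mem_ramificationSubgroup_iff_le hφ h1).2 le_rfl) m
  rw [← pow_mul, ← hgm, pow_orderOf_eq_one] at h3
  have h4 : (m : k) ≠ 0 := by rwa [Ne, CharP.cast_eq_zero_iff k p]
  have h5 := mul_ne_zero h4 (coeff_ramificationNumber_ne_zero hφ h1)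
  rw [← h3] at h5
  simp at h5

/-- `P` is the kernel of the action on the tangent space, since `k` contains no non-trivial `p`-power
roots of unity. -/
theorem sylow_eq_ramificationSubgroup_two [Finite G] (hφ : Function.Injective φ)
    (P : Sylow p G) : (P : Subgroup G) = ramificationSubgroup φ 2 := by
  refine (P.is_maximal' (isPGroup_ramificationSubgroup_two hφ) fun g hg => ?_).symm
  obtain ⟨n, hn⟩ := P.2 ⟨g, hg⟩
  have hn : g ^ p ^ n = 1 := congrArg Subtype.val hn
  rw [← tangentCoeff_eq_one_iff]
  refine eq_one_of_pow_prime_pow_eq_one (p := p) (n := n) ?_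
  have := congrArg (fun x : kˣ => (x : k)) (map_pow (tangentCharacter k) (φ g) (p ^ n))
  rw [← map_pow, hn] at this
  simpa [coe_tangentCharacter] using this.symm

end WildInertia

/-! ### The tame character -/

section TameCharacter

variable {k : Type*} [Field k]

theorem X_pow_dvd_iff_dvd {u f : k⟦X⟧} (hu : u ≠ 0) : X ^ u.order.toNat ∣ f ↔ u ∣ f := by
  have h1 : IsUnit u.divXPowOrder := by
    rw [PowerSeries.isUnit_iff_constantCoeff, isUnit_iff_ne_zero, Ne,
      PowerSeries.constantCoeff_divXPowOrder_eq_zero_iff]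
    exact hu
  have h2 : Associated (X ^ u.order.toNat) u := by
    refine ⟨h1.unit, ?_⟩
    exact PowerSeries.X_pow_order_mul_divXPowOrder
  exact h2.dvd_iff_dvd_left

variable {G : Type*} [Group G] {φ : G →* (k⟦X⟧ ≃ₐ[k] k⟦X⟧)} {P : Subgroup G}

theorem mem_invariants_of_mul {u h : k⟦X⟧} (hu : u ∈ invariants φ P) (hu0 : u ≠ 0)
    (hf : u * h ∈ invariants φ P) : h ∈ invariants φ P := by
  intro g hg
  have h1 := hf g hg
  rw [map_mul, hu g hg] at h1
  exact mul_left_cancel₀ hu0 h1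

theorem isUnit_invariants_iff (f : invariants φ P) :
    IsUnit f ↔ constantCoeff (f : k⟦X⟧) ≠ 0 := by
  constructor
  · intro h
    have := h.map (invariants φ P).val
    exact isUnit_iff_ne_zero.1 (PowerSeries.isUnit_iff_constantCoeff.1 this)
  · intro h
    obtain ⟨v, hv⟩ := PowerSeries.isUnit_iff_constantCoeff.2 (isUnit_iff_ne_zero.2 h)
    have h0 : (f : k⟦X⟧) ≠ 0 := by
      intro h0
      simp [h0] at h
    have h1 : (f : k⟦X⟧) * (v⁻¹ : (k⟦X⟧)ˣ) = 1 := by rw [← hv, Units.mul_inv]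
    have h2 : ((v⁻¹ : (k⟦X⟧)ˣ) : k⟦X⟧) ∈ invariants φ P :=
      mem_invariants_of_mul f.2 h0 (by rw [h1]; exact one_mem _)
    exact IsUnit.of_mul_eq_one ⟨_, h2⟩ (Subtype.ext h1)

/-- The product of the conjugates of `X` is an invariant of order `#P`. -/
theorem exists_mem_invariants_order [Finite P] :
    ∃ f ∈ invariants φ P, f.order = (Nat.card P : ℕ∞) := by
  have := Fintype.ofFinite P
  refine ⟨∏ g : P, φ g X, fun h hh => ?_, ?_⟩
  · rw [map_prod]
    refine Fintype.prod_equiv (Equiv.mulLeft (⟨h, hh⟩ : P)) _ _ fun g => ?_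
    simp [AlgEquiv.mul_apply]
  · rw [PowerSeries.order_prod]
    have : ∀ g : P, (φ g X).order = 1 := by
      intro g
      have h1 : (φ g X) ≠ 0 := by
        rw [Ne, EmbeddingLike.map_eq_zero_iff]
        exact PowerSeries.X_ne_zero
      refine le_antisymm ?_ ?_
      · refine PowerSeries.order_le 1 ?_
        exact (tangentCharacter k (φ g)).ne_zero
      · rw [PowerSeries.one_le_order_iff_constCoeff_eq_zero, constantCoeff_algEquiv]
        simp
    simp [this, Nat.card_eq_fintype_card]

/-- The ring of invariants has a uniformizer: an invariant of minimal positive order. This order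
divides `#P`. -/
theorem exists_invariants_uniformizer [Finite P] :
    ∃ u ∈ invariants φ P, ∃ e : ℕ, 0 < e ∧ e ∣ Nat.card P ∧ u ≠ 0 ∧ u.order.toNat = e ∧
      ∀ f ∈ invariants φ P, constantCoeff f = 0 → X ^ e ∣ f := by
  classical
  obtain ⟨f₀, hf₀, hf₀o⟩ := exists_mem_invariants_order (φ := φ) (P := P)
  let Q : ℕ → Prop := fun n => 0 < n ∧ ∃ f ∈ invariants φ P, f ≠ 0 ∧ f.order.toNat = n
  have hne : ∀ {f : k⟦X⟧} {n : ℕ}, f.order = (n : ℕ∞) → f ≠ 0 := by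
    rintro f n h rfl
    simp at h
  have hQ : ∃ n, Q n := ⟨Nat.card P, Nat.card_pos, f₀, hf₀, hne hf₀o, by rw [hf₀o]; simp⟩
  obtain ⟨hpos, u, hu, hu0, hue⟩ := Nat.find_spec hQ
  set e := Nat.find hQ with he
  have hmin : ∀ f ∈ invariants φ P, f ≠ 0 → constantCoeff f = 0 → e ≤ f.order.toNat := by
    intro f hf hf0 hfc
    refine Nat.find_min' hQ ⟨?_, f, hf, hf0, rfl⟩
    rw [Nat.pos_iff_ne_zero]
    intro h
    have := PowerSeries.coeff_order hf0
    rw [h] at this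
    exact this (by simpa using hfc)
  have hdvd : ∀ f ∈ invariants φ P, constantCoeff f = 0 → X ^ e ∣ f := by
    intro f hf hfc
    by_cases hf0 : f = 0
    · simp [hf0]
    · exact (pow_dvd_pow X (hmin f hf hf0 hfc)).trans PowerSeries.X_pow_order_dvd
  have hord : ∀ n : ℕ, ∀ f ∈ invariants φ P, f.order = (n : ℕ∞) → e ∣ n := by
    intro n
    induction n using Nat.strong_induction_on with
    | _ n ih =>
      intro f hf hfn
      rcases Nat.eq_zero_or_pos n with rfl | hn
      · exact dvd_zero e
      · have hfc : constantCoeff f = 0 := by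
          rw [← PowerSeries.one_le_order_iff_constCoeff_eq_zero, hfn]
          exact_mod_cast hn
        obtain ⟨h, rfl⟩ := (X_pow_dvd_iff_dvd hu0).1 (hue ▸ hdvd f hf hfc)
        have hh : h ∈ invariants φ P := mem_invariants_of_mul hu hu0 hf
        have hh0 : h ≠ 0 := right_ne_zero_of_mul (hne hfn)
        rw [PowerSeries.order_mul, ← PowerSeries.coe_toNat_order hu0,
          ← PowerSeries.coe_toNat_order hh0, hue] at hfn
        have hfn : e + h.order.toNat = n := by exact_mod_cast hfn
        have := ih h.order.toNat (by omega) h hh (PowerSeries.coe_toNat_order hh0).symm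
        rw [← hfn]
        exact dvd_add dvd_rfl this
  exact ⟨u, hu, e, hpos, hord _ f₀ hf₀ hf₀o, hu0, hue, hdvd⟩

variable {p : ℕ} [Fact p.Prime] [Finite G]

/-- The tame character is the action on the tangent space, up to a power of Frobenius. -/
theorem exists_tameCharacter_eq (P : Sylow p G) [hP : (P : Subgroup G).Normal] (C : Subgroup G) :
    ∃ a : ℕ, ∀ σ : C, (tameCharacter φ (P : Subgroup G) C σ : k) =
      tangentCoeff (φ σ) ^ p ^ a := by
  obtain ⟨u, hu, e, hpos, hedvd, hu0, hue, hdvd⟩ :=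
    exists_invariants_uniformizer (φ := φ) (P := (P : Subgroup G))
  obtain ⟨n, hn⟩ := P.2.exists_card_eq
  rw [hn] at hedvd
  obtain ⟨a, -, rfl⟩ := (Nat.dvd_prime_pow (Fact.out : p.Prime)).1 hedvd
  refine ⟨a, ?_⟩
  set e := p ^ a
  have huc : coeff e u ≠ 0 := hue ▸ PowerSeries.coeff_order hu0
  have hXu : X ^ e ∣ u := hue ▸ PowerSeries.X_pow_order_dvd
  have hconst : ∀ f : k⟦X⟧, X ^ e ∣ f → constantCoeff f = 0 := by
    intro f hf
    have := (PowerSeries.X_pow_dvd_iff.1 hf) 0 hpos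
    simpa using this
  have hcoeff : ∀ w : k⟦X⟧, coeff e (u * w) = coeff e u * constantCoeff w := by
    intro w
    obtain ⟨v, rfl⟩ := hXu
    rw [mul_assoc, coeff_X_pow_mul_self, coeff_X_pow_mul_self, map_mul]
  -- every irreducible invariant is associated to `u`
  have hassoc : ∀ u' : invariants φ (P : Subgroup G), Irreducible u' →
      ∃ h ∈ invariants φ (P : Subgroup G), (u' : k⟦X⟧) = u * h ∧ constantCoeff h ≠ 0 := by
    intro u' hu'
    have h1 : constantCoeff (u' : k⟦X⟧) = 0 := by
      by_contra h
      exact hu'.not_isUnit ((isUnit_invariants_iff u').2 h)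
    obtain ⟨h, hh⟩ := (X_pow_dvd_iff_dvd hu0).1 (hue ▸ hdvd u' u'.2 h1)
    have hmem : h ∈ invariants φ (P : Subgroup G) :=
      mem_invariants_of_mul hu hu0 (hh ▸ u'.2)
    refine ⟨h, hmem, hh, ?_⟩
    rcases hu'.isUnit_or_isUnit (a := ⟨u, hu⟩) (b := ⟨h, hmem⟩) (Subtype.ext hh) with h2 | h2
    · exact ((isUnit_invariants_iff _).1 h2 (hconst u hXu)).elim
    · exact (isUnit_invariants_iff _).1 h2
  have hirr : Irreducible (⟨u, hu⟩ : invariants φ (P : Subgroup G)) := by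
    refine ⟨fun h => (isUnit_invariants_iff _).1 h (hconst u hXu), fun x y hxy => ?_⟩
    by_contra! hcon
    rw [isUnit_invariants_iff, isUnit_invariants_iff, not_not, not_not] at hcon
    have hxy : u = x * y := congrArg Subtype.val hxy
    obtain ⟨x', hx'⟩ := hdvd x x.2 hcon.1
    apply huc
    rw [hxy, hx', mul_assoc, coeff_X_pow_mul_self, map_mul, hcon.2, mul_zero]
  -- for irreducible `u'`, the quotient `σ u' / u'` has constant coefficient `θ₀ σ ^ e`
  have hquot : ∀ u' : invariants φ (P : Subgroup G), Irreducible u' → ∀ σ : C,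
      ∃ w ∈ invariants φ (P : Subgroup G), φ σ (u' : k⟦X⟧) = u' * w ∧
        constantCoeff w = tangentCoeff (φ σ) ^ e := by
    intro u' hu' σ
    obtain ⟨h, hh, hu'h, hh0⟩ := hassoc u' hu'
    have hXu' : X ^ e ∣ (u' : k⟦X⟧) := hu'h ▸ hXu.mul_right h
    have hunit : IsUnit h :=
      PowerSeries.isUnit_iff_constantCoeff.2 (isUnit_iff_ne_zero.2 hh0)
    have hu'u : (u' : k⟦X⟧) ∣ u := by
      rw [hu'h]
      exact (associated_mul_unit_left u h hunit).dvd
    obtain ⟨w, hw⟩ := hu'u.trans ((X_pow_dvd_iff_dvd hu0).1 (hue ▸ X_pow_dvd_algEquiv (φ σ) hXu'))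
    have hu'0 : (u' : k⟦X⟧) ≠ 0 := by
      rintro h0
      exact hu0 (zero_dvd_iff.1 (h0 ▸ hu'u))
    have hmem : φ σ (u' : k⟦X⟧) ∈ invariants φ (P : Subgroup G) := by
      intro g hg
      have h1 := u'.2 _ (hP.conj_mem g hg (σ : G)⁻¹)
      rw [← AlgEquiv.mul_apply, ← map_mul]
      have h2 : g * (σ : G) = σ * ((σ : G)⁻¹ * g * (σ : G)⁻¹⁻¹) := by group
      rw [h2, map_mul, AlgEquiv.mul_apply, h1]
    refine ⟨w, mem_invariants_of_mul u'.2 hu'0 (hw ▸ hmem), hw, ?_⟩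
    have h3 := coeff_algEquiv (φ σ) hXu'
    have h4 : coeff e (u' : k⟦X⟧) ≠ 0 := by
      rw [hu'h, hcoeff]
      exact mul_ne_zero huc hh0
    rw [hw] at h3
    have h5 : coeff e ((u' : k⟦X⟧) * w) = coeff e (u' : k⟦X⟧) * constantCoeff w := by
      rw [hu'h, mul_assoc, hcoeff, hcoeff, map_mul, mul_assoc]
    rw [h5, mul_comm] at h3
    exact mul_right_cancel₀ h4 h3
  have hex : ∃ θ : C →* kˣ, IsTameCharacter φ (P : Subgroup G) C θ := by
    refine ⟨((tangentCharacter k).comp (φ.comp C.subtype)) ^ e, fun u' hu' σ => ?_⟩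
    obtain ⟨w, hw, hwu, hwc⟩ := hquot u' hu' σ
    obtain ⟨h, hh, hu'h, hh0⟩ := hassoc u' hu'
    set θ := ((tangentCharacter k).comp (φ.comp C.subtype)) ^ e
    have hθ : ((θ σ : kˣ) : k) = tangentCoeff (φ σ) ^ e := by
      simp [θ, coe_tangentCharacter]
    have h1 : w - algebraMap k k⟦X⟧ (θ σ : k) ∈ invariants φ (P : Subgroup G) :=
      sub_mem hw (algebraMap_mem _ _)
    have h2 : constantCoeff (w - algebraMap k k⟦X⟧ (θ σ : k)) = 0 := by
      rw [map_sub, hwc, hθ]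
      simp
    have hunit : IsUnit h :=
      PowerSeries.isUnit_iff_constantCoeff.2 (isUnit_iff_ne_zero.2 hh0)
    have hu'u : (u' : k⟦X⟧) ∣ u := by
      rw [hu'h]
      exact (associated_mul_unit_left u h hunit).dvd
    obtain ⟨v, hv⟩ := hu'u.trans ((X_pow_dvd_iff_dvd hu0).1 (hue ▸ hdvd _ h1 h2))
    have hu'0 : (u' : k⟦X⟧) ≠ 0 := by
      rintro h0
      exact hu0 (zero_dvd_iff.1 (h0 ▸ hu'u))
    refine ⟨⟨v, mem_invariants_of_mul u'.2 hu'0 (hv ▸ h1)⟩, ?_⟩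
    rw [hwu, ← hv]
    ring
  intro σ
  obtain ⟨v, hv⟩ := Classical.epsilon_spec hex ⟨u, hu⟩ hirr σ
  obtain ⟨w, -, hwu, hwc⟩ := hquot ⟨u, hu⟩ hirr σ
  rw [hwu] at hv
  have hv := mul_left_cancel₀ hu0 hv
  rw [← hwc, hv, map_add, map_mul]
  simp only [hconst u hXu, zero_mul, add_zero]
  simp only [tameCharacter]
  simp

end TameCharacter

/-! ### The conjugation character on a cyclic `p`-group -/

section ConjugationCharacter

variable {p : ℕ} [Fact p.Prime]

theorem ringHom_padicInt_eq_toZMod (f : ℤ_[p] →+* ZMod p) : f = PadicInt.toZMod := by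
  ext x
  have h := PadicInt.toZMod_spec (p := p) x
  rw [PadicInt.maximalIdeal_eq_span_p, Ideal.mem_span_singleton] at h
  obtain ⟨y, hy⟩ := h
  have h1 := congrArg f hy
  rw [map_sub, map_mul, map_natCast, CharP.cast_eq_zero, zero_mul, sub_eq_zero] at h1
  rw [h1, ZMod.cast_eq_val, map_natCast, ZMod.natCast_zmod_val]

/-- Teichmüller representatives in `ℤ_[p]`, obtained from those of the Witt vectors of `ZMod p`. -/
theorem exists_teichmuller_padicInt :
    ∃ ω : ZMod p →* ℤ_[p], ∀ a, PadicInt.toZMod (ω a) = a := by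
  refine ⟨((WittVector.equiv p : WittVector p (ZMod p) ≃+* ℤ_[p]) :
    WittVector p (ZMod p) →* ℤ_[p]).comp (WittVector.teichmuller p), fun a => ?_⟩
  have h := ringHom_padicInt_eq_toZMod (p := p)
    (WittVector.constantCoeff.comp (WittVector.equiv p).symm.toRingHom)
  rw [← h]
  simp

theorem castHom_toZModPow {n : ℕ} (hn : n ≠ 0) (z : ℤ_[p]) :
    ZMod.castHom (dvd_pow_self p hn) (ZMod p) (PadicInt.toZModPow n z) = PadicInt.toZMod z :=
  congrArg (fun f => f z) (ringHom_padicInt_eq_toZMod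
    ((ZMod.castHom (dvd_pow_self p hn) (ZMod p)).comp (PadicInt.toZModPow n)))

theorem zmod_eq_one_of_pow_eq_one {n : ℕ} (hn : n ≠ 0) {M : ℕ} (hM : M.Coprime p)
    {t : ZMod (p ^ n)} (ht : t ^ M = 1) (h : ZMod.castHom (dvd_pow_self p hn) (ZMod p) t = 1) :
    t = 1 := by
  have h1 : t ^ p ^ n = 1 := by
    obtain ⟨a, rfl⟩ := ZMod.intCast_surjective t
    rw [map_intCast, ← Int.cast_one, ZMod.intCast_eq_intCast_iff_dvd_sub, ← dvd_neg,
      neg_sub] at h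
    have h2 := (dvd_sub_pow_of_dvd_sub h n)
    rw [one_pow] at h2
    rw [← Int.cast_pow, ← Int.cast_one, eq_comm, ZMod.intCast_eq_intCast_iff_dvd_sub]
    refine dvd_trans ?_ h2
    push_cast
    exact pow_dvd_pow _ (Nat.le_succ n)
  have h2 := pow_gcd_eq_one.2 ⟨ht, h1⟩
  rwa [Nat.Coprime.gcd_eq_one (hM.pow_right n), pow_one] at h2

theorem zmod_eq_of_pow_eq_one {n : ℕ} (hn : n ≠ 0) {M : ℕ} (hM0 : M ≠ 0) (hM : M.Coprime p)
    {r s : ZMod (p ^ n)} (hr : r ^ M = 1) (hs : s ^ M = 1)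
    (h : ZMod.castHom (dvd_pow_self p hn) (ZMod p) r =
      ZMod.castHom (dvd_pow_self p hn) (ZMod p) s) : r = s := by
  obtain ⟨M, rfl⟩ := Nat.exists_eq_succ_of_ne_zero hM0
  have h1 : r * s ^ M = 1 := by
    refine zmod_eq_one_of_pow_eq_one hn hM ?_ ?_
    · rw [mul_pow, hr, ← pow_mul, mul_comm M, pow_mul, hs, one_pow, one_mul]
    · rw [map_mul, map_pow, h, ← map_pow, ← map_mul, ← pow_succ', hs, map_one]
  calc r = r * s ^ (M + 1) := by rw [hs, mul_one]
    _ = r * s ^ M * s := by rw [pow_succ, mul_assoc]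
    _ = s := by rw [h1, one_mul]

variable {G : Type*} [Group G]

theorem pow_toZModPow_val_eq {y : G} {a b : ℕ} (ha : y ^ p ^ a = 1) (hb : y ^ p ^ b = 1)
    (z : ℤ_[p]) :
    y ^ (PadicInt.toZModPow a z).val = y ^ (PadicInt.toZModPow b z).val := by
  wlog hab : a ≤ b generalizing a b
  · exact (this hb ha (le_of_not_ge hab)).symm
  rw [pow_eq_pow_iff_modEq]
  refine Nat.ModEq.of_dvd (orderOf_dvd_of_pow_eq_one ha) ?_
  rw [← ZMod.natCast_eq_natCast_iff, ZMod.natCast_zmod_val, ZMod.natCast_val,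
    PadicInt.cast_toZModPow a b hab]

theorem exists_conj_eq_pow_of_mem_normalizer [Finite G] {T : Subgroup G} (hT : IsCyclic T) {x : G}
    (hx : x ∈ Subgroup.normalizer (T : Set G)) : ∃ m : ℕ, ∀ y ∈ T, x * y * x⁻¹ = y ^ m := by
  obtain ⟨y₀, rfl⟩ := exists_zpowers_eq hT
  have h1 : x * y₀ * x⁻¹ ∈ Subgroup.zpowers y₀ :=
    (Subgroup.mem_normalizer_iff.1 hx y₀).1 (Subgroup.mem_zpowers y₀)
  obtain ⟨m, hm⟩ := mem_powers_iff_mem_zpowers.2 h1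
  have hm : y₀ ^ m = x * y₀ * x⁻¹ := hm
  refine ⟨m, fun y hy => ?_⟩
  obtain ⟨j, rfl⟩ := hy
  change x * y₀ ^ j * x⁻¹ = (y₀ ^ j) ^ m
  rw [← conj_zpow, ← hm, ← zpow_natCast, ← zpow_natCast, ← zpow_mul, ← zpow_mul, mul_comm]

theorem conj_pow_iterate {x y : G} {m : ℕ} (h : x * y * x⁻¹ = y ^ m) (j : ℕ) :
    x ^ j * y * (x ^ j)⁻¹ = y ^ m ^ j := by
  induction j with
  | zero => simp
  | succ j ih =>
    have : x ^ (j + 1) * y * (x ^ (j + 1))⁻¹ = x * (x ^ j * y * (x ^ j)⁻¹) * x⁻¹ := by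
      rw [pow_succ']
      group
    rw [this, ih, ← conj_pow, h, ← pow_mul, ← pow_succ']

theorem exists_isConjugationCharacter [Finite G] {N T : Subgroup G} (hT : IsCyclic T)
    (hT1 : T ≠ ⊥) (hTp : IsPGroup p T) (hN : N ≤ Subgroup.normalizer (T : Set G))
    (hNp : (Nat.card N).Coprime p) :
    ∃ χ : N →* ℤ_[p]ˣ, IsConjugationCharacter p N T χ := by
  obtain ⟨n, hn⟩ := hTp.exists_card_eq
  have hn0 : n ≠ 0 := by
    rintro rfl
    exact hT1 (Subgroup.card_eq_one.1 (by simpa using hn))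
  choose e he using fun x : N => exists_conj_eq_pow_of_mem_normalizer hT (hN x.2)
  obtain ⟨y₀, hy₀⟩ := exists_zpowers_eq hT
  have hy₀T : y₀ ∈ T := hy₀ ▸ Subgroup.mem_zpowers y₀
  have ho : orderOf y₀ = p ^ n := by rw [← Nat.card_zpowers, hy₀, hn]
  have hcast : ∀ a b : ℕ, y₀ ^ a = y₀ ^ b ↔ (a : ZMod (p ^ n)) = b := by
    intro a b
    rw [pow_eq_pow_iff_modEq, ho, ZMod.natCast_eq_natCast_iff]
  let E : N →* ZMod (p ^ n) :=
    { toFun := fun x => e x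
      map_one' := by
        rw [← Nat.cast_one, ← hcast, ← he 1 y₀ hy₀T]
        simp
      map_mul' := fun x x' => by
        rw [← Nat.cast_mul, ← hcast, ← he _ y₀ hy₀T, mul_comm (e x), pow_mul,
          ← he x _ (T.pow_mem hy₀T _), ← he _ y₀ hy₀T, Subgroup.coe_mul]
        group }
  obtain ⟨ω, hω⟩ := exists_teichmuller_padicInt (p := p)
  let χ₀ : N →* ℤ_[p] :=
    ω.comp ((ZMod.castHom (dvd_pow_self p hn0) (ZMod p) : ZMod (p ^ n) →* ZMod p).comp E)
  refine ⟨χ₀.toHomUnits, fun x y hy a hya => ?_⟩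
  have hpow : ∀ {A : Type} [Monoid A] (f : N →* A), f x ^ Nat.card N = 1 := by
    intro A _ f
    rw [← map_pow, pow_card_eq_one', map_one]
  have hE : PadicInt.toZModPow n (χ₀ x) = E x := by
    refine zmod_eq_of_pow_eq_one hn0 Nat.card_pos.ne' hNp ?_ (hpow E) ?_
    · rw [← map_pow, hpow χ₀, map_one]
    · rw [castHom_toZModPow hn0]
      exact hω _
  have hyn : y ^ p ^ n = 1 := by
    have := pow_card_eq_one' (x := (⟨y, hy⟩ : T))
    rw [hn] at this
    exact congrArg Subtype.val this
  change (x : G) * y * (x : G)⁻¹ = y ^ (PadicInt.toZModPow a (χ₀ x)).val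
  rw [pow_toZModPow_val_eq hya hyn, hE, he x y hy, pow_eq_pow_iff_modEq]
  refine Nat.ModEq.of_dvd (orderOf_dvd_of_pow_eq_one hyn) ?_
  rw [← ZMod.natCast_eq_natCast_iff, ZMod.natCast_zmod_val]
  rfl

theorem exists_mem_orderOf_eq_prime [Finite G] {T : Subgroup G} (hT1 : T ≠ ⊥)
    (hTp : IsPGroup p T) : ∃ y ∈ T, orderOf y = p := by
  obtain ⟨n, hn⟩ := hTp.exists_card_eq
  have hn0 : n ≠ 0 := by
    rintro rfl
    exact hT1 (Subgroup.card_eq_one.1 (by simpa using hn))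
  obtain ⟨y, hy⟩ := exists_prime_orderOf_dvd_card' (G := T) p (hn ▸ dvd_pow_self p hn0)
  exact ⟨y, y.2, by rw [Subgroup.orderOf_coe, hy]⟩

/-- The reduction modulo `p` of the conjugation character is determined by the action on `T`. -/
theorem toZMod_conjugationCharacter [Finite G] {C T : Subgroup G} (hT : IsCyclic T)
    (hT1 : T ≠ ⊥) (hTp : IsPGroup p T) (hC : (Nat.card C).Coprime p) (x : normalizerIn C T)
    {m : ℕ} {Γ : Subgroup G} (hΓ : T ≤ Γ) (hm : ∀ y ∈ Γ, (x : G) * y * (x : G)⁻¹ = y ^ m) :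
    PadicInt.toZMod (conjugationCharacter p C T x : ℤ_[p]) = m := by
  have hex := exists_isConjugationCharacter (N := normalizerIn C T) hT hT1 hTp inf_le_left
    (hC.coprime_dvd_left (Subgroup.card_dvd_of_le inf_le_right))
  have hχ : IsConjugationCharacter p (normalizerIn C T) T (conjugationCharacter p C T) :=
    Classical.epsilon_spec hex
  obtain ⟨y, hy, hyo⟩ := exists_mem_orderOf_eq_prime hT1 hTp
  have h1 := hχ x y hy 1 (by rw [pow_one, ← hyo, pow_orderOf_eq_one])
  rw [hm y (hΓ hy), pow_eq_pow_iff_modEq, hyo, ← ZMod.natCast_eq_natCast_iff] at h1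
  rw [h1, ← castHom_toZModPow one_ne_zero]
  set z := PadicInt.toZModPow 1 (conjugationCharacter p C T x : ℤ_[p])
  conv_lhs => rw [← ZMod.natCast_zmod_val z]
  rw [map_natCast]

/-- A `p'`-element normalizing a cyclic `p`-group and centralizing a non-trivial subgroup of it
centralizes it. -/
theorem centralizes_of_centralizes_le [Finite G] {T Γ : Subgroup G} (hΓ : IsCyclic Γ)
    (hT1 : T ≠ ⊥) (hTΓ : T ≤ Γ) (hΓp : IsPGroup p Γ) {x : G} (hx : (orderOf x).Coprime p)
    (hxN : x ∈ Subgroup.normalizer (Γ : Set G)) (hxT : ∀ y ∈ T, x * y = y * x) :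
    ∀ y ∈ Γ, x * y = y * x := by
  obtain ⟨n, hn⟩ := hΓp.exists_card_eq
  have hn0 : n ≠ 0 := by
    rintro rfl
    exact hT1 (le_bot_iff.1 (hTΓ.trans (Subgroup.card_eq_one.1 (by simpa using hn)).le))
  obtain ⟨y₀, hy₀⟩ := exists_zpowers_eq hΓ
  have hy₀Γ : y₀ ∈ Γ := hy₀ ▸ Subgroup.mem_zpowers y₀
  have ho : orderOf y₀ = p ^ n := by rw [← Nat.card_zpowers, hy₀, hn]
  obtain ⟨m, hm⟩ := exists_conj_eq_pow_of_mem_normalizer hΓ hxN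
  obtain ⟨y, hy, hyo⟩ := exists_mem_orderOf_eq_prime hT1 (hΓp.to_le hTΓ)
  have h1 : (m : ZMod (p ^ n)) = 1 := by
    refine zmod_eq_one_of_pow_eq_one hn0 hx ?_ ?_
    · have h2 := conj_pow_iterate (hm y₀ hy₀Γ) (orderOf x)
      rw [pow_orderOf_eq_one, one_mul, inv_one, mul_one] at h2
      rw [← Nat.cast_pow, ← Nat.cast_one, ZMod.natCast_eq_natCast_iff, ← ho,
        ← pow_eq_pow_iff_modEq, ← h2, pow_one]
    · rw [map_natCast, ← Nat.cast_one, ZMod.natCast_eq_natCast_iff, ← hyo,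
        ← pow_eq_pow_iff_modEq, ← hm y (hTΓ hy), hxT y hy, pow_one]
      group
  rw [← Nat.cast_one, ZMod.natCast_eq_natCast_iff, ← hn] at h1
  intro z hz
  have h2 : z ^ m = z ^ 1 := by
    rw [pow_eq_pow_iff_modEq]
    refine Nat.ModEq.of_dvd ?_ h1
    exact Subgroup.orderOf_dvd_natCard Γ hz
  rw [← mul_inv_eq_iff_eq_mul, hm z hz, h2, pow_one]

end ConjugationCharacter

/-! ### Divisibility by orbits, and groups with a normal Sylow subgroup -/

section Divisibility

attribute [local instance] subgroupFintype

/-- The sum of an invariant function over a finite `N`-set is divisible by `#N` as soon as each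
value is divisible by the order of the stabilizer: so is the sum over each orbit. -/
theorem card_dvd_sum_of_stabilizer_dvd {N Y : Type*} [Group N] [Finite N] [MulAction N Y]
    [Fintype Y] {f : Y → ℤ} (hinv : ∀ (x : N) (y : Y), f (x • y) = f y)
    (hdvd : ∀ y, (Nat.card (MulAction.stabilizer N y) : ℤ) ∣ f y) :
    (Nat.card N : ℤ) ∣ ∑ y, f y := by
  classical
  have : Fintype (MulAction.orbitRel.Quotient N Y) := Fintype.ofFinite _
  rw [← Finset.sum_fiberwise Finset.univ
    (fun y : Y => (Quotient.mk (MulAction.orbitRel N Y) y : MulAction.orbitRel.Quotient N Y))]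
  refine Finset.dvd_sum fun ω _ => ?_
  obtain ⟨y₀, rfl⟩ := Quotient.exists_rep ω
  have h1 : ∀ y : Y, (Quotient.mk (MulAction.orbitRel N Y) y = Quotient.mk _ y₀) ↔
      y ∈ MulAction.orbit N y₀ := fun y => Quotient.eq
  have h2 : ∀ y ∈ Finset.univ.filter (fun y : Y =>
      (Quotient.mk (MulAction.orbitRel N Y) y = Quotient.mk _ y₀)), f y = f y₀ := by
    intro y hy
    simp only [Finset.mem_filter, Finset.mem_univ, true_and, h1] at hy
    obtain ⟨x, rfl⟩ := hy
    exact hinv x y₀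
  rw [Finset.sum_congr rfl h2, Finset.sum_const, nsmul_eq_mul]
  have h3 : (Finset.univ.filter (fun y : Y =>
      (Quotient.mk (MulAction.orbitRel N Y) y = Quotient.mk _ y₀))).card =
      Nat.card (MulAction.orbit N y₀) := by
    simp only [h1]
    rw [← Fintype.card_subtype, Nat.card_eq_fintype_card]
  have h4 : Nat.card N = Nat.card (MulAction.orbit N y₀) *
      Nat.card (MulAction.stabilizer N y₀) := by
    rw [← Nat.card_prod]
    exact Nat.card_congr (MulAction.orbitProdStabilizerEquivGroup N y₀).symm
  rw [h3, h4, Nat.cast_mul]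
  exact mul_dvd_mul_left _ (hdvd y₀)

theorem card_dvd_sum_of_conj_invariant {G : Type*} [Group G] [Finite G] {N : Subgroup G}
    {f : Subgroup G → ℤ}
    (hinv : ∀ x ∈ N, ∀ Γ : Subgroup G, f (Γ.map (MulAut.conj x).toMonoidHom) = f Γ)
    (hdvd : ∀ Γ : Subgroup G, (Nat.card (normalizerIn N Γ) : ℤ) ∣ f Γ) :
    (Nat.card N : ℤ) ∣ ∑ Γ, f Γ := by
  let _ : MulAction N (Subgroup G) :=
    { smul := fun x Γ => Γ.map (MulAut.conj (x : G)).toMonoidHom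
      one_smul := fun Γ => by
        change Γ.map (MulAut.conj (1 : G)).toMonoidHom = Γ
        rw [map_one]
        exact Subgroup.map_id Γ
      mul_smul := fun x y Γ => by
        change Γ.map (MulAut.conj ((x : G) * y)).toMonoidHom =
          (Γ.map (MulAut.conj (y : G)).toMonoidHom).map (MulAut.conj (x : G)).toMonoidHom
        rw [Subgroup.map_map, map_mul]
        rfl }
  refine card_dvd_sum_of_stabilizer_dvd (fun x Γ => hinv x x.2 Γ) fun Γ => ?_
  have : MulAction.stabilizer N Γ = (normalizerIn N Γ).subgroupOf N := by
    ext x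
    rw [MulAction.mem_stabilizer_iff, Subgroup.mem_subgroupOf, normalizerIn, Subgroup.mem_inf,
      and_iff_left x.2, ← map_conj_eq_iff_mem_normalizer]
    rfl
  have hle : normalizerIn N Γ ≤ N := inf_le_right
  rw [this, Nat.card_congr (Subgroup.subgroupOfEquivOfLe hle).toEquiv]
  exact hdvd Γ

end Divisibility

section NormalSylow

theorem normalizer_map_conj {G : Type*} [Group G] (T : Subgroup G) (g : G) :
    Subgroup.normalizer (T.map (MulAut.conj g).toMonoidHom : Set G) =
      (Subgroup.normalizer (T : Set G)).map (MulAut.conj g).toMonoidHom :=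
  (Subgroup.map_equiv_normalizer_eq T (MulAut.conj g)).symm

theorem relIndex_normalizer_map_conj {G : Type*} [Group G] (T : Subgroup G) (g : G) :
    (T.map (MulAut.conj g).toMonoidHom).relIndex
        (Subgroup.normalizer (T.map (MulAut.conj g).toMonoidHom : Set G)) =
      T.relIndex (Subgroup.normalizer (T : Set G)) := by
  rw [normalizer_map_conj, Subgroup.relIndex_map_map_of_injective _ _ (MulAut.conj g).injective]

theorem exists_mul_of_isComplement' {G : Type*} [Group G] {P C : Subgroup G}
    (hPC : Subgroup.IsComplement' P C) (g : G) : ∃ x ∈ P, ∃ c ∈ C, g = x * c := by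
  obtain ⟨⟨x, c⟩, h⟩ := hPC.2 g
  exact ⟨x, x.2, c, c.2, h.symm⟩

theorem relIndex_normalizerIn_dvd {G : Type*} [Group G] {T H : Subgroup G} (hT : T ≤ H) :
    T.relIndex (normalizerIn H T) ∣ T.relIndex (Subgroup.normalizer (T : Set G)) := by
  have h1 : T ≤ normalizerIn H T := le_inf Subgroup.le_normalizer hT
  exact ⟨_, (Subgroup.relIndex_mul_relIndex _ _ _ h1 inf_le_left).symm⟩

theorem card_map_mk'_complement {G : Type*} [Group G] {P C : Subgroup G} [hP : P.Normal]
    (hPC : Subgroup.IsComplement' P C) {D : Subgroup G} (hD : D ≤ C) :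
    Nat.card (D.map (QuotientGroup.mk' P)) = Nat.card D := by
  rw [← Subgroup.relIndex_ker, QuotientGroup.ker_mk', ← Subgroup.inf_relIndex_right]
  have : P ⊓ D = ⊥ := le_bot_iff.1 ((inf_le_inf_left _ hD).trans hPC.disjoint.le_bot)
  rw [this, Subgroup.relIndex_bot_left]

variable {p : ℕ} [Fact p.Prime] {G : Type*} [Group G] [Finite G] {P : Sylow p G} {C : Subgroup G}

theorem card_complement_coprime (hPC : Subgroup.IsComplement' (P : Subgroup G) C) :
    (Nat.card C).Coprime p := by
  have h := P.not_dvd_index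
  rw [hPC.symm.index_eq_card] at h
  exact ((Nat.Prime.coprime_iff_not_dvd (Fact.out : p.Prime)).2 h).symm

theorem le_sylow_of_isPGroup [hP : (P : Subgroup G).Normal] {T : Subgroup G}
    (hT : IsPGroup p T) : T ≤ P := by
  obtain ⟨Q, hQ⟩ := hT.exists_le_sylow
  have := Sylow.unique_of_normal P hP
  rwa [Subsingleton.elim Q P] at hQ

/-- A subgroup not contained in `P` has an element of prime order `ℓ ≠ p`, which fixes a point of
`G ⧸ C` because `#(G ⧸ C) = #P` is prime to `ℓ`. -/
theorem exists_conj_mem_complement [hP : (P : Subgroup G).Normal]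
    (hPC : Subgroup.IsComplement' (P : Subgroup G) C) {T : Subgroup G}
    (hT : ¬ T ≤ (P : Subgroup G)) :
    ∃ x : G, ∃ t ∈ C, t ≠ 1 ∧ t ∈ T.map (MulAut.conj x).toMonoidHom := by
  have h1 : ∃ ℓ : ℕ, ℓ.Prime ∧ ℓ ∣ Nat.card T ∧ ℓ ≠ p := by
    by_contra! h
    refine hT (le_sylow_of_isPGroup (IsPGroup.of_card (n := (Nat.card T).primeFactorsList.length)
      ?_))
    exact Nat.eq_prime_pow_of_unique_prime_dvd Nat.card_pos.ne' fun {d} hd hd' => h d hd hd'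
  obtain ⟨ℓ, hℓ, hℓT, hℓp⟩ := h1
  have := Fact.mk hℓ
  obtain ⟨y, hy⟩ := exists_prime_orderOf_dvd_card' (G := T) ℓ hℓT
  have hy' : orderOf (y : G) = ℓ := by rw [Subgroup.orderOf_coe, hy]
  have hgrp : IsPGroup ℓ (Subgroup.zpowers (y : G)) :=
    IsPGroup.of_card (n := 1) (by rw [Nat.card_zpowers, hy', pow_one])
  have hcard : ¬ ℓ ∣ Nat.card (G ⧸ C) := by
    change ¬ ℓ ∣ C.index
    rw [hPC.index_eq_card]
    obtain ⟨n, hn⟩ := P.2.exists_card_eq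
    rw [hn]
    intro h
    exact hℓp ((Nat.prime_dvd_prime_iff_eq hℓ Fact.out).1 (hℓ.dvd_of_dvd_pow h))
  obtain ⟨q, hq⟩ := hgrp.nonempty_fixed_point_of_prime_not_dvd_card (G ⧸ C) hcard
  obtain ⟨g, rfl⟩ := QuotientGroup.mk_surjective q
  have h2 := hq ⟨y, Subgroup.mem_zpowers _⟩
  have h2 : ((((y : G) * g : G)) : G ⧸ C) = g := h2
  have h3 := QuotientGroup.eq.1 h2.symm
  refine ⟨g⁻¹, g⁻¹ * (y * g), h3, ?_, ⟨y, y.2, by simp [mul_assoc]⟩⟩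
  intro h
  have h4 : (y : G) = 1 := by
    have := congrArg (fun z => g * z * g⁻¹) h
    simpa [mul_assoc] using this
  rw [h4, orderOf_one] at hy'
  exact hℓ.one_lt.ne hy'

/-- Two `p'`-elements in the same coset of a normal `p`-subgroup are conjugate: the elements
`z c u z⁻¹` with `z` modulo `C_P(c)` and `u ∈ C_P(c)` are distinct, hence fill the coset. -/
theorem exists_conj_eq_of_mul_inv_mem [hP : (P : Subgroup G).Normal] {c d : G}
    (hc : (orderOf c).Coprime p) (hd : (orderOf d).Coprime p) (hdc : d * c⁻¹ ∈ (P : Subgroup G)) :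
    ∃ z ∈ (P : Subgroup G), d = z * c * z⁻¹ := by
  obtain ⟨n, hn⟩ := P.2.exists_card_eq
  have hpow : ∀ x ∈ (P : Subgroup G), x ^ p ^ n = 1 := by
    intro x hx
    have := pow_card_eq_one' (x := (⟨x, hx⟩ : (P : Subgroup G)))
    rw [hn] at this
    exact congrArg Subtype.val this
  -- raising to the power `e` extracts the `p'`-part of `c u`
  obtain ⟨e, he1, he2⟩ := Nat.chineseRemainder (hc.pow_right n) 1 0
  have hpart : ∀ u ∈ (P : Subgroup G), Commute c u → (c * u) ^ e = c := by
    intro u hu hcu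
    rw [hcu.mul_pow]
    have h1 : c ^ e = c ^ 1 := pow_eq_pow_iff_modEq.2 he1
    have h2 : u ^ e = u ^ 0 :=
      pow_eq_pow_iff_modEq.2 (he2.of_dvd (orderOf_dvd_of_pow_eq_one (hpow u hu)))
    rw [h1, h2, pow_one, pow_zero, mul_one]
  set K := (Subgroup.centralizer ({c} : Set G)).subgroupOf (P : Subgroup G) with hK
  have hKmem : ∀ u : (P : Subgroup G), u ∈ K ↔ Commute c u := by
    intro u
    rw [hK, Subgroup.mem_subgroupOf, Subgroup.mem_centralizer_singleton_iff]
    exact ⟨Eq.symm, Eq.symm⟩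
  have hmem : ∀ z u : (P : Subgroup G), (z : G) * (c * u) * (z : G)⁻¹ * c⁻¹ ∈ (P : Subgroup G) := by
    intro z u
    have h1 := hP.conj_mem _ (mul_mem u.2 (inv_mem z.2)) c
    have h2 : (z : G) * (c * u) * (z : G)⁻¹ * c⁻¹ = z * (c * (u * (z : G)⁻¹) * c⁻¹) := by group
    rw [h2]
    exact mul_mem z.2 h1
  let F : ((P : Subgroup G) ⧸ K) × K → (P : Subgroup G) := fun a =>
    ⟨(a.1.out : G) * (c * (a.2 : (P : Subgroup G))) * (a.1.out : G)⁻¹ * c⁻¹, hmem a.1.out a.2⟩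
  have hF : Function.Injective F := by
    rintro ⟨q, u⟩ ⟨q', u'⟩ h
    have h1 : (q.out : G) * (c * (u : (P : Subgroup G))) * (q.out : G)⁻¹ =
        (q'.out : G) * (c * (u' : (P : Subgroup G))) * (q'.out : G)⁻¹ :=
      mul_right_cancel (congrArg Subtype.val h)
    have h2 := congrArg (fun x => x ^ e) h1
    simp only [conj_pow] at h2
    rw [hpart _ (u : (P : Subgroup G)).2 ((hKmem _).1 u.2),
      hpart _ (u' : (P : Subgroup G)).2 ((hKmem _).1 u'.2)] at h2
    have h3 : q.out⁻¹ * q'.out ∈ K := by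
      rw [hKmem]
      have h4 := congrArg (fun x => (q.out : G)⁻¹ * x * q'.out) h2
      simp only [mul_assoc, inv_mul_cancel_left, inv_mul_cancel, mul_one] at h4
      simpa [Commute, SemiconjBy, mul_assoc] using h4
    have h5 : q = q' := by
      rw [← q.out_eq', ← q'.out_eq']
      exact QuotientGroup.eq.2 h3
    subst h5
    have h6 := mul_left_cancel (mul_left_cancel (mul_right_cancel h1))
    rw [Subtype.ext (Subtype.ext h6)]
  have hbij := (Nat.bijective_iff_injective_and_card F).2 ⟨hF, by
    rw [Nat.card_prod, mul_comm]
    exact K.card_mul_index⟩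
  obtain ⟨⟨q, u⟩, hqu⟩ := hbij.2 ⟨d * c⁻¹, hdc⟩
  have h1 : (q.out : G) * (c * (u : (P : Subgroup G))) * (q.out : G)⁻¹ = d :=
    mul_right_cancel (congrArg Subtype.val hqu)
  refine ⟨q.out, q.out.2, ?_⟩
  have h2 : ((c : G) * (u : (P : Subgroup G))) ^ orderOf d = 1 := by
    have h3 := pow_orderOf_eq_one d
    rw [← h1, conj_pow, h1] at h3
    have := congrArg (fun x => (q.out : G)⁻¹ * x * q.out) h3
    simpa [mul_assoc] using this
  have hcu := (hKmem _).1 u.2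
  rw [hcu.mul_pow] at h2
  have h4 : (((u : (P : Subgroup G)) : G)) ^ (orderOf d * orderOf c) = 1 := by
    have := congrArg (fun x => x ^ orderOf c) h2
    simp only [one_pow] at this
    rw [(hcu.pow_pow _ _).mul_pow, ← pow_mul c, mul_comm (orderOf d) (orderOf c), pow_mul c,
      pow_orderOf_eq_one, one_pow, one_mul, ← pow_mul] at this
    exact this
  have h5 := pow_gcd_eq_one.2 ⟨h4, hpow _ (u : (P : Subgroup G)).2⟩
  rw [((hd.mul_left hc).pow_right n).gcd_eq_one, pow_one] at h5
  rw [← h1, h5, mul_one]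

theorem card_normalizerIn_dvd {T : Subgroup G} (hPC : Subgroup.IsComplement' (P : Subgroup G) C)
    (hT : T ≤ P) :
    Nat.card (normalizerIn C T) ∣ T.relIndex (Subgroup.normalizer (T : Set G)) := by
  have h1 : Nat.card (normalizerIn C T) ∣
      Nat.card T * T.relIndex (Subgroup.normalizer (T : Set G)) := by
    rw [card_mul_relIndex_of_le Subgroup.le_normalizer]
    exact Subgroup.card_dvd_of_le inf_le_left
  refine Nat.Coprime.dvd_of_dvd_mul_left ?_ h1
  obtain ⟨n, hn⟩ := (P.2.to_le hT).exists_card_eq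
  rw [hn]
  exact ((card_complement_coprime hPC).coprime_dvd_left
    (Subgroup.card_dvd_of_le inf_le_right)).pow_right n

/-- After conjugation, the normalizer of a subgroup of `P` is the product of its intersections with
`P` and `C`. -/
theorem exists_conj_relIndex_normalizer_eq [hP : (P : Subgroup G).Normal]
    (hPC : Subgroup.IsComplement' (P : Subgroup G) C) (hC : IsCyclic C) {T : Subgroup G}
    (hT : T ≤ P) : ∃ z : G, ∃ T' : Subgroup G, T' = T.map (MulAut.conj z).toMonoidHom ∧ T' ≤ P ∧
      T'.relIndex (Subgroup.normalizer (T' : Set G)) =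
        T'.relIndex (normalizerIn (P : Subgroup G) T') * Nat.card (normalizerIn C T') := by
  set π := QuotientGroup.mk' (P : Subgroup G) with hπ
  have hπP : ∀ z : G, π z = 1 ↔ z ∈ (P : Subgroup G) := fun z => QuotientGroup.eq_one_iff z
  -- an element `d` of `p'`-order generating the image of the normalizer
  have hcyc : IsCyclic (G ⧸ (P : Subgroup G)) := by
    refine isCyclic_of_surjective (π.comp C.subtype) fun q => ?_
    obtain ⟨g, rfl⟩ := QuotientGroup.mk_surjective q
    obtain ⟨x, hx, c, hc, rfl⟩ := exists_mul_of_isComplement' hPC g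
    refine ⟨⟨c, hc⟩, ?_⟩
    have : π (x * c) = π c := by rw [map_mul, (hπP x).2 hx, one_mul]
    exact this.symm
  obtain ⟨y, hy⟩ := exists_zpowers_eq (T := (Subgroup.normalizer (T : Set G)).map π) inferInstance
  obtain ⟨h, hh, rfl⟩ : y ∈ (Subgroup.normalizer (T : Set G)).map π :=
    hy ▸ Subgroup.mem_zpowers y
  set d := h ^ Nat.card (P : Subgroup G) with hd
  have hdN : d ∈ Subgroup.normalizer (T : Set G) := Subgroup.pow_mem _ hh _
  have hdord : d ^ Nat.card C = 1 := by
    rw [hd, ← pow_mul, hPC.card_mul_card, pow_card_eq_one']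
  have hCp := card_complement_coprime hPC
  have hdcop : (orderOf d).Coprime p := hCp.coprime_dvd_left (orderOf_dvd_of_pow_eq_one hdord)
  have hgen : Subgroup.zpowers (π d) = (Subgroup.normalizer (T : Set G)).map π := by
    rw [← hy, hd, map_pow]
    refine le_antisymm (Subgroup.zpowers_le.2 (Subgroup.pow_mem _ (Subgroup.mem_zpowers _) _))
      (Subgroup.zpowers_le.2 (mem_zpowers_pow_iff.2 ?_))
    have h1 : orderOf (π h) ∣ Nat.card C := by
      rw [← hPC.symm.index_eq_card]
      exact orderOf_dvd_natCard (π h)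
    obtain ⟨n, hn⟩ := P.2.exists_card_eq
    rw [hn]
    exact Nat.Coprime.pow_left n (hCp.coprime_dvd_left h1).symm
  obtain ⟨x, hx, c, hc, hdxc⟩ := exists_mul_of_isComplement' hPC d
  have hcop : (orderOf c).Coprime p :=
    hCp.coprime_dvd_left (Subgroup.orderOf_dvd_natCard C hc)
  obtain ⟨z, hz, hzd⟩ := exists_conj_eq_of_mul_inv_mem (P := P) hcop hdcop (by
    rw [hdxc, mul_inv_cancel_right]; exact hx)
  refine ⟨z⁻¹, _, rfl, ?_, ?_⟩
  · rintro _ ⟨w, hw, rfl⟩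
    exact hP.conj_mem w (hT hw) z⁻¹
  set T' := T.map (MulAut.conj z⁻¹).toMonoidHom with hT'
  have hTle : T' ≤ P := by
    rintro _ ⟨w, hw, rfl⟩
    exact hP.conj_mem w (hT hw) z⁻¹
  have hmapN : ∀ g, g ∈ Subgroup.normalizer (T' : Set G) ↔
      z * g * z⁻¹ ∈ Subgroup.normalizer (T : Set G) := by
    intro g
    rw [normalizer_map_conj]
    refine ⟨?_, fun h => ⟨_, h, by simp [mul_assoc]⟩⟩
    rintro ⟨w, hw, rfl⟩
    simpa [mul_assoc] using hw
  have hcN : c ∈ normalizerIn C T' := ⟨(hmapN c).2 (hzd ▸ hdN), hc⟩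
  have hπz : π z = 1 := (hπP z).2 hz
  have himg : (normalizerIn C T').map π = (Subgroup.normalizer (T' : Set G)).map π := by
    refine le_antisymm (Subgroup.map_mono inf_le_left) ?_
    rintro _ ⟨g, hg, rfl⟩
    have h1 : π (z * g * z⁻¹) ∈ Subgroup.zpowers (π d) :=
      hgen ▸ ⟨_, (hmapN g).1 hg, rfl⟩
    have h2 : π (z * g * z⁻¹) = π g := by rw [map_mul, map_mul, map_inv, hπz]; simp
    have h3 : π d = π c := by rw [hzd, map_mul, map_mul, map_inv, hπz]; simp
    rw [h2, h3] at h1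
    obtain ⟨j, hj⟩ := h1
    exact ⟨c ^ j, Subgroup.zpow_mem _ hcN j, by rw [map_zpow]; exact hj⟩
  have hle : normalizerIn C T' ≤ C := inf_le_right
  have h4 : T' ≤ normalizerIn (P : Subgroup G) T' := le_inf Subgroup.le_normalizer hTle
  rw [← Subgroup.relIndex_mul_relIndex _ _ _ h4
      (inf_le_left : _ ≤ Subgroup.normalizer (T' : Set G)),
    ← card_map_mk'_complement hPC hle, himg,
    ← Subgroup.relIndex_ker, QuotientGroup.ker_mk', normalizerIn, Subgroup.inf_relIndex_left]

end NormalSylow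

/-! ### The wild inertia group `P` and the subgroups outside it -/

section TameQuotient

attribute [local instance] subgroupFintype

theorem tangentCoeff_pow {k : Type*} [Field k] {G : Type*} [Group G]
    {φ : G →* (k⟦X⟧ ≃ₐ[k] k⟦X⟧)} (g : G) (n : ℕ) :
    tangentCoeff (φ (g ^ n)) = tangentCoeff (φ g) ^ n := by
  rw [← coe_tangentCharacter, map_pow, map_pow, Units.val_pow_eq_pow_val, coe_tangentCharacter]

theorem commute_of_isCyclic {G : Type*} [Group G] {H : Subgroup G} (hH : IsCyclic H)
    {x y : G} (hx : x ∈ H) (hy : y ∈ H) : x * y = y * x := by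
  obtain ⟨g, rfl⟩ := exists_zpowers_eq hH
  obtain ⟨a, rfl⟩ := hx
  obtain ⟨b, rfl⟩ := hy
  exact zpow_mul_comm g a b

theorem le_centralizer_of_isCyclic {G : Type*} [Group G] {H : Subgroup G} (hH : IsCyclic H)
    {t : G} (ht : t ∈ H) : H ≤ Subgroup.centralizer ({t} : Set G) := fun x hx => by
  rw [Subgroup.mem_centralizer_singleton_iff]
  exact commute_of_isCyclic hH hx ht

variable {p : ℕ} [Fact p.Prime] {k : Type*} [Field k] [CharP k p] {G : Type*} [Group G] [Finite G]
  {φ : G →* (k⟦X⟧ ≃ₐ[k] k⟦X⟧)}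

theorem mem_sylow_iff_tangentCoeff (hφ : Function.Injective φ) (P : Sylow p G) (g : G) :
    g ∈ (P : Subgroup G) ↔ tangentCoeff (φ g) = 1 := by
  rw [tangentCoeff_eq_one_iff, sylow_eq_ramificationSubgroup_two hφ P]

theorem sylow_normal (hφ : Function.Injective φ) (P : Sylow p G) : (P : Subgroup G).Normal := by
  rw [sylow_eq_ramificationSubgroup_two hφ P]
  infer_instance

theorem ramificationOn_eq_one (hφ : Function.Injective φ) (P : Sylow p G) {Γ : Subgroup G}
    (hΓ : IsCyclic Γ) (hΓP : ¬ Γ ≤ (P : Subgroup G)) : ramificationOn φ Γ = 1 := by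
  obtain ⟨g, rfl⟩ := exists_zpowers_eq hΓ
  rw [Subgroup.zpowers_le, mem_sylow_iff_tangentCoeff hφ P] at hΓP
  have hg : g ≠ 1 := by
    rintro rfl
    exact hΓP ((mem_sylow_iff_tangentCoeff hφ P 1).1 (one_mem _))
  rw [ramificationOn_zpowers_of_ne_one hφ hg, (ramificationNumber_eq_one_iff hφ hg).2 hΓP,
    Nat.cast_one]

variable {P : Sylow p G} {C : Subgroup G}

theorem eq_one_of_tangentCoeff_eq_one (hφ : Function.Injective φ)
    (hPC : Subgroup.IsComplement' (P : Subgroup G) C) {c : G} (hc : c ∈ C)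
    (h : tangentCoeff (φ c) = 1) : c = 1 :=
  Subgroup.disjoint_def.1 hPC.disjoint ((mem_sylow_iff_tangentCoeff hφ P c).2 h) hc

theorem isCyclic_complement (hφ : Function.Injective φ)
    (hPC : Subgroup.IsComplement' (P : Subgroup G) C) : IsCyclic C := by
  refine isCyclic_of_injective_ringHom
    ((Units.coeHom k).comp ((tangentCharacter k).comp (φ.comp C.subtype))) ?_
  rw [injective_iff_map_eq_one]
  intro c hc
  exact Subtype.ext (eq_one_of_tangentCoeff_eq_one hφ hPC c.2 hc)

/-- If the centralizer of `t ∈ C` is cyclic, it is the direct product of its `p`-part and `C`. -/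
theorem isInternalProduct_centralizer {G : Type*} [Group G] {P C : Subgroup G}
    (hPC : Subgroup.IsComplement' P C)
    (hC : IsCyclic C) {t : G} (ht : t ∈ C)
    (hcyc : IsCyclic (Subgroup.centralizer ({t} : Set G))) :
    IsInternalProduct (Subgroup.centralizer ({t} : Set G) ⊓ P) C
        (Subgroup.centralizer ({t} : Set G)) ∧
      IsInternalProduct (centralizerIn P C) C
        (Subgroup.centralizer ({t} : Set G)) := by
  have hCM := le_centralizer_of_isCyclic hC ht
  have h1 : IsInternalProduct (Subgroup.centralizer ({t} : Set G) ⊓ P) C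
      (Subgroup.centralizer ({t} : Set G)) := by
    refine ⟨le_antisymm (sup_le inf_le_left hCM) fun m hm => ?_, ?_, fun a ha b hb =>
      commute_of_isCyclic hcyc ha.1 (hCM hb)⟩
    · obtain ⟨x, hx, c, hc, rfl⟩ := exists_mul_of_isComplement' hPC m
      refine Subgroup.mul_mem_sup ⟨?_, hx⟩ hc
      have := mul_mem hm (inv_mem (hCM hc))
      rwa [mul_inv_cancel_right] at this
    · exact le_bot_iff.1 ((inf_le_inf_right _ inf_le_right).trans hPC.disjoint.le_bot)
  have h2 : centralizerIn P C =
      Subgroup.centralizer ({t} : Set G) ⊓ P := by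
    refine le_antisymm (inf_le_inf_right _ ?_) (le_inf ?_ inf_le_right)
    · exact Subgroup.centralizer_le (by simpa using ht)
    · rintro x ⟨hx, -⟩
      rw [Subgroup.mem_centralizer_iff]
      exact fun c hc => commute_of_isCyclic hcyc (hCM hc) hx
  exact ⟨h1, h2 ▸ h1⟩

open scoped Classical in
/-- The Möbius sums over subgroups not contained in `P`: all cyclic overgroups of `T` lie in a
cyclic centralizer `M`, so that the sum vanishes unless `T = M`, which is self-normalizing. -/
theorem moebiusSum_of_not_le (hφ : Function.Injective φ)
    (hPC : Subgroup.IsComplement' (P : Subgroup G) C)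
    (hb : ∀ t ∈ C, t ≠ 1 → IsCyclic (Subgroup.centralizer ({t} : Set G)))
    {T : Subgroup G} (hT : IsCyclic T) (hTP : ¬ T ≤ (P : Subgroup G)) :
    0 ≤ moebiusSum (ramificationOn φ) T ∧
      (T.relIndex (Subgroup.normalizer (T : Set G)) : ℤ) ∣ moebiusSum (ramificationOn φ) T := by
  have hP := sylow_normal hφ P
  have hC := isCyclic_complement hφ hPC
  obtain ⟨x, t, ht, ht1, htT⟩ := exists_conj_mem_complement hPC hTP
  rw [← moebiusSum_map_conj (ramificationOn_map_conj φ) T x, ← relIndex_normalizer_map_conj T x]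
  have hT' := isCyclic_map_conj hT x
  set T' := T.map (MulAut.conj x).toMonoidHom
  have hTP' : ¬ T' ≤ (P : Subgroup G) := by
    intro h
    exact ht1 (Subgroup.disjoint_def.1 hPC.disjoint (h htT) ht)
  set M := Subgroup.centralizer ({t} : Set G) with hM
  have hMc : IsCyclic M := hb t ht ht1
  have hTM : T' ≤ M := le_centralizer_of_isCyclic hT' htT
  have hsum : moebiusSum (ramificationOn φ) T' = if T' = M then 1 else 0 := by
    rw [← sum_moebius_relIndex_left hMc hTM, moebiusSum]
    have hset : Finset.univ.filter (fun Γ : Subgroup G => T' ≤ Γ ∧ IsCyclic Γ) =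
        Finset.univ.filter (fun Γ : Subgroup G => T' ≤ Γ ∧ Γ ≤ M) := by
      ext Γ
      simp only [Finset.mem_filter, Finset.mem_univ, true_and]
      refine and_congr_right fun h =>
        ⟨fun hΓ => le_centralizer_of_isCyclic hΓ (h htT), fun hΓ => ?_⟩
      exact Subgroup.isCyclic_of_le hΓ
    rw [hset]
    refine Finset.sum_congr rfl fun Γ hΓ => ?_
    simp only [Finset.mem_filter, Finset.mem_univ, true_and] at hΓ
    have hΓc : IsCyclic Γ := Subgroup.isCyclic_of_le hΓ.2
    rw [ramificationOn_eq_one hφ P hΓc fun h => hTP' (hΓ.1.trans h), mul_one, Int.cast_id]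
  rw [hsum]
  split_ifs with hTM'
  · refine ⟨zero_le_one, ?_⟩
    have hle : Subgroup.normalizer (T' : Set G) ≤ T' := by
      rw [hTM']
      intro n hn
      have hCM : C ≤ M := le_centralizer_of_isCyclic hC ht
      obtain ⟨y, hy, c, hc, rfl⟩ := exists_mul_of_isComplement' hPC n
      refine mul_mem ?_ (hCM hc)
      have hyN : y ∈ Subgroup.normalizer (M : Set G) := by
        have := mul_mem hn (inv_mem (Subgroup.le_normalizer (hCM hc)))
        rwa [mul_inv_cancel_right] at this
      -- `C` is the only subgroup of its order in the cyclic group `M`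
      have hconj : C.map (MulAut.conj y).toMonoidHom ≤ C := by
        refine (le_iff_card_dvd_of_isCyclic hMc ?_ hCM).2 ?_
        · rw [← (map_conj_eq_iff_mem_normalizer M y).2 hyN]
          exact Subgroup.map_mono hCM
        · exact (Nat.card_congr (C.equivMapOfInjective _
            (MulAut.conj y).injective).toEquiv).symm.dvd
      have h1 : y * t * y⁻¹ ∈ C := hconj ⟨t, ht, rfl⟩
      have h2 : y * t * y⁻¹ * t⁻¹ ∈ (P : Subgroup G) := by
        have h3 := mul_mem hy (hP.conj_mem _ (inv_mem hy) t)
        have h4 : y * t * y⁻¹ * t⁻¹ = y * (t * y⁻¹ * t⁻¹) := by group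
        rwa [h4]
      have h5 := Subgroup.disjoint_def.1 hPC.disjoint h2 (mul_mem h1 (inv_mem ht))
      rw [hM, Subgroup.mem_centralizer_singleton_iff]
      exact mul_inv_eq_iff_eq_mul.1 (mul_inv_eq_one.1 h5)
    rw [Subgroup.relIndex_eq_one.2 hle, Nat.cast_one]
  · exact ⟨le_rfl, dvd_zero _⟩

/-- A non-trivial `t ∈ C` has exactly one fixed point, whose stabilizer is cyclic and contains the
centralizer of `t`. -/
theorem IsBertinSet.exists_centralizer_le_stabilizer (hφ : Function.Injective φ)
    (hPC : Subgroup.IsComplement' (P : Subgroup G) C) {S : Type*} [MulAction G S]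
    (hS : IsBertinSet (ramificationOn φ) S) {t : G} (ht : t ∈ C) (ht1 : t ≠ 1) :
    ∃ s : S, Subgroup.centralizer ({t} : Set G) ≤ MulAction.stabilizer G s ∧
      ∀ s' : S, t • s' = s' → s' = s := by
  have h1 := hS.2 t ht1
  rw [ramificationOn_zpowers_of_ne_one hφ ht1, (ramificationNumber_eq_one_iff hφ ht1).2 fun h =>
    ht1 (eq_one_of_tangentCoeff_eq_one hφ hPC ht h)] at h1
  have h1 : Nat.card (MulAction.fixedBy S t) = 1 := by exact_mod_cast h1
  obtain ⟨hsub, ⟨s, hs⟩⟩ := Nat.card_eq_one_iff_unique.1 h1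
  have hs : t • s = s := hs
  have huniq : ∀ s' : S, t • s' = s' → s' = s := fun s' hs' =>
    congrArg Subtype.val (hsub.elim (⟨s', hs'⟩ : MulAction.fixedBy S t) ⟨s, hs⟩)
  refine ⟨s, fun g hg => ?_, huniq⟩
  rw [Subgroup.mem_centralizer_singleton_iff] at hg
  refine huniq _ ?_
  rw [← mul_smul, ← hg, mul_smul, hs]

end TameQuotient

/-! ### Möbius sums over the subgroups of `P` -/

section WildPart

attribute [local instance] subgroupFintype

section Sums

variable {G : Type*} [Group G] [Finite G]

/-- The part of the Möbius transform of `F` at `T` which comes from the subgroups of `P`. -/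
def moebiusSumIn (P : Subgroup G) (F : Subgroup G → ℤ) (T : Subgroup G) : ℤ :=
  open scoped Classical in
  ∑ Γ : Subgroup G with (T ≤ Γ ∧ IsCyclic Γ) ∧ Γ ≤ P,
    ArithmeticFunction.moebius (T.relIndex Γ) * F Γ

theorem mem_cyclicOver_iff {G : Type*} [Group G] {T Γ : Subgroup G} (hT : T ≠ ⊥) :
    Γ ∈ cyclicOver T ↔ T ≤ Γ ∧ IsCyclic Γ := by
  refine ⟨fun h => ⟨h.2.2, h.2.1⟩, fun h => ⟨?_, h.2, h.1⟩⟩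
  rintro rfl
  exact hT (le_bot_iff.1 h.1)

open scoped Classical in
theorem bPrime_eq_sum {T : Subgroup G} (hT : T ≠ ⊥) (P : Subgroup G) :
    bPrime P T = ∑ Γ : Subgroup G with (T ≤ Γ ∧ IsCyclic Γ) ∧ ¬ Γ ≤ P,
      ArithmeticFunction.moebius (T.relIndex Γ) := by
  rw [bPrime, finsum_eq_sum_of_fintype, Finset.sum_filter]
  refine Finset.sum_congr rfl fun Γ _ => ?_
  rw [finsum_eq_if, mem_cyclicOver_iff hT]
  congr

open scoped Classical in
theorem moebiusSum_eq_add_bPrime {T P : Subgroup G} (hT : T ≠ ⊥) {F : Subgroup G → ℤ}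
    (hF : ∀ Γ : Subgroup G, IsCyclic Γ → ¬ Γ ≤ P → F Γ = 1) :
    moebiusSum F T = moebiusSumIn P F T + bPrime P T := by
  rw [bPrime_eq_sum hT, moebiusSum, moebiusSumIn, ← Finset.sum_filter_add_sum_filter_not _ (· ≤ P),
    Finset.filter_filter, Finset.filter_filter]
  congr 1
  refine Finset.sum_congr rfl fun Γ hΓ => ?_
  simp only [Finset.mem_filter, Finset.mem_univ, true_and] at hΓ
  rw [hF Γ hΓ.1.2 hΓ.2, mul_one, Int.cast_id]

open scoped Classical in
theorem bDoublePrime_eq_add_bPrime {T : Subgroup G} (hT : T ≠ ⊥) (P : Subgroup G) :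
    bDoublePrime T = moebiusSumIn P (fun _ => 1) T + bPrime P T := by
  rw [← moebiusSum_eq_add_bPrime hT (fun _ _ _ => rfl), bDoublePrime, finsum_eq_sum_of_fintype,
    moebiusSum, Finset.sum_filter]
  refine Finset.sum_congr rfl fun Γ _ => ?_
  rw [finsum_eq_if, mem_cyclicOver_iff hT, mul_one, Int.cast_id]
  congr

open scoped Classical in
/-- The Möbius sum over the cyclic subgroups of `P` is computed orbit by orbit under a group of
automorphisms of `P`. -/
theorem card_dvd_moebiusSumIn {T P N : Subgroup G} [hP : P.Normal] {F : Subgroup G → ℤ}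
    (hN : N ≤ Subgroup.normalizer (T : Set G))
    (hF : ∀ (Γ : Subgroup G) (g : G), F (Γ.map (MulAut.conj g).toMonoidHom) = F Γ)
    (hdvd : ∀ Γ : Subgroup G, T ≤ Γ → IsCyclic Γ → Γ ≤ P →
      (Nat.card (normalizerIn N Γ) : ℤ) ∣ F Γ) :
    (Nat.card N : ℤ) ∣ moebiusSumIn P F T := by
  rw [moebiusSumIn, Finset.sum_filter]
  refine card_dvd_sum_of_conj_invariant (fun x hx Γ => ?_) fun Γ => ?_
  · have hxT := (map_conj_eq_iff_mem_normalizer T x).2 (hN hx)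
    have hinj := (MulAut.conj x).injective
    have h1 : T ≤ Γ.map (MulAut.conj x).toMonoidHom ↔ T ≤ Γ := by
      conv_lhs => rw [← hxT]
      exact Subgroup.map_le_map_iff_of_injective hinj
    have h2 : IsCyclic (Γ.map (MulAut.conj x).toMonoidHom) ↔ IsCyclic Γ :=
      (Γ.equivMapOfInjective _ hinj).isCyclic.symm
    have h3 : Γ.map (MulAut.conj x).toMonoidHom ≤ P ↔ Γ ≤ P := by
      have h4 : P.map (MulAut.conj x).toMonoidHom = P :=
        (map_conj_eq_iff_mem_normalizer P x).2 (by rw [Subgroup.normalizer_eq_top]; trivial)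
      conv_lhs => rw [← h4]
      exact Subgroup.map_le_map_iff_of_injective hinj
    have h5 : T.relIndex (Γ.map (MulAut.conj x).toMonoidHom) = T.relIndex Γ := by
      conv_lhs => rw [← hxT]
      exact Subgroup.relIndex_map_map_of_injective _ _ hinj
    simp only [h1, h2, h3, h5, hF]
  · split_ifs with h
    · exact (hdvd Γ h.1.1 h.1.2 h.2).mul_left _
    · exact dvd_zero _

end Sums

variable {p : ℕ} [Fact p.Prime] {k : Type*} [Field k] [CharP k p] {G : Type*} [Group G] [Finite G]
  {φ : G →* (k⟦X⟧ ≃ₐ[k] k⟦X⟧)} {P : Sylow p G} {C : Subgroup G}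

theorem moebiusSum_comp_subtype {k : Type*} [Field k] (φ : G →* (k⟦X⟧ ≃ₐ[k] k⟦X⟧))
    {H T : Subgroup G} (hT : T ≠ ⊥) (hTH : T ≤ H) :
    moebiusSum (ramificationOn (φ.comp H.subtype)) (T.subgroupOf H) =
      moebiusSumIn H (ramificationOn φ) T := by
  rw [moebiusSum_subgroupOf hTH (F := ramificationOn φ), moebiusSumIn]
  · simp only [Int.cast_id]
  · intro Γ h1 h2
    refine ramificationOn_subgroupOf φ ?_ h2
    rintro rfl
    exact hT (le_bot_iff.1 h1)

theorem isCyclic_subgroupOf {G : Type*} [Group G] {H T : Subgroup G} (hTH : T ≤ H)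
    (hT : IsCyclic T) : IsCyclic (T.subgroupOf H) :=
  (Subgroup.subgroupOfEquivOfLe hTH).isCyclic.2 hT

theorem relIndex_mul_bertinConstant_restrict (hφ : Function.Injective φ) {H T : Subgroup G}
    (hT : T ≠ ⊥) (hTc : IsCyclic T) (hTH : T ≤ H) :
    (T.relIndex (normalizerIn H T) : ℚ) * bertinConstant (φ.comp H.subtype) (T.subgroupOf H) =
      (moebiusSumIn H (ramificationOn φ) T : ℚ) := by
  rw [← moebiusSum_comp_subtype φ hT hTH, ← relIndex_normalizer_subgroupOf hTH]
  exact relIndex_mul_bertinConstant _ (ramificationOn_map_conj _)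
    (ramificationOn_zpowers (injective_comp_subtype hφ H)) (isCyclic_subgroupOf hTH hTc)

theorem relIndex_dvd_moebiusSumIn (hφ : Function.Injective φ) {H T : Subgroup G}
    (ha : BertinVanishes (φ.comp H.subtype)) (hT : T ≠ ⊥) (hTc : IsCyclic T) (hTH : T ≤ H) :
    (T.relIndex (normalizerIn H T) : ℤ) ∣ moebiusSumIn H (ramificationOn φ) T := by
  rw [← moebiusSum_comp_subtype φ hT hTH, ← relIndex_normalizer_subgroupOf hTH]
  refine ((bertinVanishes_iff (injective_comp_subtype hφ H)).1 ha _ ?_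
    (isCyclic_subgroupOf hTH hTc)).2
  rw [Ne, Subgroup.subgroupOf_eq_bot, disjoint_iff, inf_eq_left.2 hTH]
  exact hT

/-- If `x ∈ C` is a generator of a subgroup `D` and `θ₀(x) ^ n = 1`, then `#D` divides `n`. -/
theorem card_dvd_of_tangentCoeff_pow_eq_one (hφ : Function.Injective φ)
    (hPC : Subgroup.IsComplement' (P : Subgroup G) C) {x : G} (hx : x ∈ C) {n : ℕ}
    (h : tangentCoeff (φ x) ^ n = 1) : Nat.card (Subgroup.zpowers x) ∣ n := by
  rw [Nat.card_zpowers, orderOf_dvd_iff_pow_eq_one]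
  refine eq_one_of_tangentCoeff_eq_one hφ hPC (C.pow_mem hx n) ?_
  rw [tangentCoeff_pow, h]

theorem ramificationNumber_pos {k : Type*} [Field k] {G : Type*} [Group G]
    {φ : G →* (k⟦X⟧ ≃ₐ[k] k⟦X⟧)} (hφ : Function.Injective φ) {g : G} (hg : g ≠ 1) :
    1 ≤ ramificationNumber φ g :=
  (mem_ramificationSubgroup_iff_le hφ hg).1 (mem_ramificationSubgroup_one g)

/-- If `C_C(T) ≠ 1` then `C` centralizes `T`, and the ramification numbers of the subgroups of `P`
centralized by `C` are congruent to `1` modulo `#C`. -/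
theorem normalizerIn_eq_and_card_dvd_of_centralizerIn_ne_bot (hφ : Function.Injective φ)
    (hPC : Subgroup.IsComplement' (P : Subgroup G) C)
    (hb : ∀ t ∈ C, t ≠ 1 → IsCyclic (Subgroup.centralizer ({t} : Set G)))
    {T : Subgroup G} (hT : T ≠ ⊥) (h : centralizerIn C T ≠ ⊥) :
    normalizerIn C T = C ∧
      (Nat.card C : ℤ) ∣ moebiusSumIn (P : Subgroup G) (ramificationOn φ) T -
        moebiusSumIn (P : Subgroup G) (fun _ => 1) T := by
  have hP := sylow_normal hφ P
  have hC := isCyclic_complement hφ hPC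
  have hcent : ∀ {Γ : Subgroup G} {t : G}, t ∈ C → t ≠ 1 → (∀ y ∈ Γ, t * y = y * t) →
      ∀ c ∈ C, ∀ y ∈ Γ, c * y = y * c := by
    intro Γ t ht ht1 hΓ c hc y hy
    refine commute_of_isCyclic (hb t ht ht1) (le_centralizer_of_isCyclic hC ht hc) ?_
    rw [Subgroup.mem_centralizer_singleton_iff]
    exact (hΓ y hy).symm
  obtain ⟨t, ht, ht1⟩ := (centralizerIn C T).bot_or_exists_ne_one.resolve_left h
  have hCT : ∀ c ∈ C, ∀ y ∈ T, c * y = y * c :=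
    hcent ht.2 ht1 fun y hy => (Subgroup.mem_centralizer_iff.1 ht.1 y hy).symm
  have hCN : C ≤ Subgroup.normalizer (T : Set G) := by
    intro c hc
    refine Subgroup.centralizer_le_normalizer _ ?_
    rw [Subgroup.mem_centralizer_iff]
    exact fun y hy => (hCT c hc y hy).symm
  refine ⟨inf_eq_right.2 hCN, ?_⟩
  have hsub : moebiusSumIn (P : Subgroup G) (ramificationOn φ) T -
        moebiusSumIn (P : Subgroup G) (fun _ => 1) T =
      moebiusSumIn (P : Subgroup G) (fun Γ => ramificationOn φ Γ - 1) T := by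
    simp only [moebiusSumIn, ← Finset.sum_sub_distrib, mul_sub]
  rw [hsub]
  refine card_dvd_moebiusSumIn hCN (fun Γ g => by simp only [ramificationOn_map_conj])
    fun Γ hTΓ hΓ hΓP => ?_
  by_cases hN : normalizerIn C Γ = ⊥
  · rw [hN]
    simp
  obtain ⟨x, hx, hx1⟩ := (normalizerIn C Γ).bot_or_exists_ne_one.resolve_left hN
  have hxΓ := centralizes_of_centralizes_le hΓ hT hTΓ (P.2.to_le hΓP)
    ((card_complement_coprime hPC).coprime_dvd_left (Subgroup.orderOf_dvd_natCard C hx.2))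
    hx.1 (hCT x hx.2)
  have hCΓ := hcent hx.2 hx1 hxΓ
  obtain ⟨c, rfl⟩ := exists_zpowers_eq hC
  have hcC := Subgroup.mem_zpowers c
  obtain ⟨γ, rfl⟩ := exists_zpowers_eq hΓ
  have hγ1 : γ ≠ 1 := by
    rintro rfl
    exact hT (le_bot_iff.1 (hTΓ.trans (Subgroup.zpowers_one_eq_bot).le))
  have hγ2 : γ ∈ ramificationSubgroup φ 2 :=
    sylow_eq_ramificationSubgroup_two hφ P ▸ hΓP (Subgroup.mem_zpowers γ)
  have h1 := tangentCoeff_pow_eq hφ (x := c) (m := 1) hγ1 hγ2 (by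
    rw [pow_one, hCΓ c hcC γ (Subgroup.mem_zpowers γ), mul_inv_cancel_right])
  rw [Nat.cast_one] at h1
  have h2 := card_dvd_of_tangentCoeff_pow_eq_one hφ hPC hcC h1
  rw [ramificationOn_zpowers_of_ne_one hφ hγ1]
  have h3 : ((ramificationNumber φ γ - 1 : ℕ) : ℤ) = (ramificationNumber φ γ : ℤ) - 1 :=
    Nat.cast_pred (ramificationNumber_pos hφ hγ1)
  rw [← h3, Int.natCast_dvd_natCast]
  exact (Subgroup.card_dvd_of_le inf_le_right).trans h2

/-- If `θ₀ χ_T = 1` on `N_C(T)`, the ramification number of each cyclic `Γ ⊆ P` containing `T` is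
divisible by `#N_{N_C(T)}(Γ)`. -/
theorem card_dvd_of_tangentCoeff_mul_eq_one (hφ : Function.Injective φ)
    (hPC : Subgroup.IsComplement' (P : Subgroup G) C) {T : Subgroup G} (hT : T ≠ ⊥)
    (hTc : IsCyclic T) (hTP : T ≤ (P : Subgroup G))
    (h : ∀ x : normalizerIn C T, tangentCoeff (φ x) * ZMod.castHom (dvd_refl p) k
      (PadicInt.toZMod (conjugationCharacter p C T x : ℤ_[p])) = 1) :
    (Nat.card (normalizerIn C T) : ℤ) ∣ moebiusSumIn (P : Subgroup G) (ramificationOn φ) T := by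
  have hP := sylow_normal hφ P
  have hC := isCyclic_complement hφ hPC
  refine card_dvd_moebiusSumIn inf_le_left (ramificationOn_map_conj φ) fun Γ hTΓ hΓ hΓP => ?_
  have hle : normalizerIn (normalizerIn C T) Γ ≤ C := inf_le_right.trans inf_le_right
  obtain ⟨x, hx⟩ := exists_zpowers_eq (Subgroup.isCyclic_of_le hle)
  have hxN : x ∈ normalizerIn (normalizerIn C T) Γ := hx ▸ Subgroup.mem_zpowers x
  obtain ⟨m, hm⟩ := exists_conj_eq_pow_of_mem_normalizer hΓ hxN.1
  have h1 := h ⟨x, hxN.2⟩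
  rw [toZMod_conjugationCharacter hTc hT (P.2.to_le hTP) (card_complement_coprime hPC)
    ⟨x, hxN.2⟩ hTΓ hm, map_natCast] at h1
  obtain ⟨γ, rfl⟩ := exists_zpowers_eq hΓ
  have hγ1 : γ ≠ 1 := by
    rintro rfl
    exact hT (le_bot_iff.1 (hTΓ.trans (Subgroup.zpowers_one_eq_bot).le))
  have hγ2 : γ ∈ ramificationSubgroup φ 2 :=
    sylow_eq_ramificationSubgroup_two hφ P ▸ hΓP (Subgroup.mem_zpowers γ)
  rw [← tangentCoeff_pow_eq hφ hγ1 hγ2 (hm γ (Subgroup.mem_zpowers γ)), ← pow_succ',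
    Nat.sub_add_cancel (ramificationNumber_pos hφ hγ1)] at h1
  rw [ramificationOn_zpowers_of_ne_one hφ hγ1, Int.natCast_dvd_natCast, ← hx]
  exact card_dvd_of_tangentCoeff_pow_eq_one hφ hPC (hle hxN) h1

/-- If the Bertin obstruction vanishes and `C_C(T) = 1`, then `N_C(T)` acts freely on the fixed
points of `T`, whose number is the ramification number of `T`; hence `θ₀ χ_T = 1`. -/
theorem tangentCoeff_mul_eq_one_of_isBertinSet (hφ : Function.Injective φ)
    (hPC : Subgroup.IsComplement' (P : Subgroup G) C) {S : Type*} [Finite S] [MulAction G S]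
    (hS : IsBertinSet (ramificationOn φ) S) {T : Subgroup G} (hT : T ≠ ⊥)
    (hTc : IsCyclic T) (hTP : T ≤ (P : Subgroup G)) (hCT : centralizerIn C T = ⊥)
    (x : normalizerIn C T) :
    tangentCoeff (φ x) * ZMod.castHom (dvd_refl p) k
      (PadicInt.toZMod (conjugationCharacter p C T x : ℤ_[p])) = 1 := by
  have hC := isCyclic_complement hφ hPC
  obtain ⟨g, hg⟩ := exists_zpowers_eq hTc
  have hg1 : g ≠ 1 := by
    rintro rfl
    exact hT (hg.symm.trans Subgroup.zpowers_one_eq_bot)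
  have hgT : g ∈ T := hg ▸ Subgroup.mem_zpowers g
  have hg2 : g ∈ ramificationSubgroup φ 2 :=
    sylow_eq_ramificationSubgroup_two hφ P ▸ hTP hgT
  let S' : SubMulAction (normalizerIn C T) S :=
    { carrier := {s | T ≤ MulAction.stabilizer G s}
      smul_mem' := by
        intro y s hs
        have hs : T ≤ MulAction.stabilizer G s := hs
        change T ≤ MulAction.stabilizer G ((y : G) • s)
        rw [MulAction.stabilizer_smul_eq_stabilizer_map_conj]
        exact ((map_conj_eq_iff_mem_normalizer T (y : G)).2 y.2.1).ge.trans (Subgroup.map_mono hs) }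
  have hcard : Nat.card S' = ramificationNumber φ g := by
    have h1 := hS.2 g hg1
    rw [ramificationOn_zpowers_of_ne_one hφ hg1] at h1
    have h1 : permCharacter S g = ramificationNumber φ g := by exact_mod_cast h1
    rw [← h1]
    refine Nat.card_congr (Equiv.subtypeEquivRight fun s => ?_)
    change T ≤ MulAction.stabilizer G s ↔ g • s = s
    rw [← hg, Subgroup.zpowers_le, MulAction.mem_stabilizer_iff]
  have hfree : ∀ s : S', MulAction.stabilizer (normalizerIn C T) s = ⊥ := by
    intro s
    rw [eq_bot_iff]
    intro y hy
    have hys : (y : G) • (s : S) = s := congrArg Subtype.val hy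
    by_contra hy1
    have hy1 : (y : G) ≠ 1 := fun h => hy1 (Subtype.ext h)
    obtain ⟨s₀, hs₀, huniq⟩ := hS.exists_centralizer_le_stabilizer hφ hPC y.2.2 hy1
    have hss₀ : (s : S) = s₀ := huniq s hys
    have hy2 : (y : G) ∈ centralizerIn C T := by
      refine ⟨Subgroup.mem_centralizer_iff.2 fun z hz => ?_, y.2.2⟩
      exact commute_of_isCyclic (hS.1 s).2 (s.2 hz) hys
    rw [hCT] at hy2
    exact hy1 hy2
  have hdvd : Nat.card (normalizerIn C T) ∣ ramificationNumber φ g := by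
    rw [← hcard]
    have := Fintype.ofFinite S'
    have h1 := card_dvd_sum_of_stabilizer_dvd (N := normalizerIn C T) (Y := S') (f := fun _ => 1)
      (fun _ _ => rfl) (fun s => by rw [hfree s]; simp)
    simpa [Int.natCast_dvd_natCast, Nat.card_eq_fintype_card] using h1
  obtain ⟨m, hm⟩ := exists_conj_eq_pow_of_mem_normalizer hTc x.2.1
  rw [toZMod_conjugationCharacter hTc hT (P.2.to_le hTP) (card_complement_coprime hPC)
    x le_rfl hm, map_natCast, ← tangentCoeff_pow_eq hφ hg1 hg2 (hm g hgT), ← pow_succ',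
    Nat.sub_add_cancel (ramificationNumber_pos hφ hg1), ← tangentCoeff_pow]
  have h2 : (x : G) ^ ramificationNumber φ g = 1 := by
    obtain ⟨c, hc⟩ := hdvd
    have h3 : (x : G) ^ Nat.card (normalizerIn C T) = 1 :=
      congrArg Subtype.val (pow_card_eq_one' (x := x))
    rw [hc, pow_mul, h3, one_pow]
  rw [h2, map_one]
  simp [tangentCoeff]

theorem castHom_pow_prime_pow (a : ZMod p) (n : ℕ) :
    ZMod.castHom (dvd_refl p) k a ^ p ^ n = ZMod.castHom (dvd_refl p) k a := by
  rw [← map_pow, ZMod.pow_card_pow]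

/-- The condition on Teichmüller lifts says that `θ₀ χ_T = 1`: the tame character differs from `θ₀`
by a power of Frobenius, which is trivial on the prime field. -/
theorem isTeichmullerLift_inv_iff (hφ : Function.Injective φ) (T : Subgroup G) :
    IsTeichmullerLift p (restrictToNormalizer (tameCharacter φ (P : Subgroup G) C) T)
        (conjugationCharacter p C T)⁻¹ ↔
      ∀ x : normalizerIn C T, tangentCoeff (φ x) * ZMod.castHom (dvd_refl p) k
        (PadicInt.toZMod (conjugationCharacter p C T x : ℤ_[p])) = 1 := by
  have hP := sylow_normal hφ P
  obtain ⟨a, ha⟩ := exists_tameCharacter_eq (φ := φ) P C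
  refine forall_congr' fun x => ?_
  have h1 : ((restrictToNormalizer (tameCharacter φ (P : Subgroup G) C) T x : kˣ) : k) =
      tangentCoeff (φ x) ^ p ^ a := ha _
  rw [h1]
  set v : ZMod p := PadicInt.toZMod (((conjugationCharacter p C T)⁻¹ x : ℤ_[p]ˣ) : ℤ_[p])
  set w : ZMod p := PadicInt.toZMod (conjugationCharacter p C T x : ℤ_[p])
  have hvw : ZMod.castHom (dvd_refl p) k v * ZMod.castHom (dvd_refl p) k w = 1 := by
    rw [← map_mul, ← map_mul, MonoidHom.inv_apply, Units.inv_mul, map_one, map_one]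
  constructor
  · intro h
    have h2 : (tangentCoeff (φ x) * ZMod.castHom (dvd_refl p) k w) ^ p ^ a = 1 := by
      rw [mul_pow, ← h, castHom_pow_prime_pow, hvw]
    exact eq_one_of_pow_prime_pow_eq_one h2
  · intro h
    have h2 : ZMod.castHom (dvd_refl p) k w ≠ 0 := right_ne_zero_of_mul_eq_one h
    rw [mul_right_cancel₀ h2 (h.trans hvw.symm), castHom_pow_prime_pow]

theorem injective_restrictToNormalizer (hφ : Function.Injective φ)
    (hPC : Subgroup.IsComplement' (P : Subgroup G) C) (T : Subgroup G) :
    Function.Injective (restrictToNormalizer (tameCharacter φ (P : Subgroup G) C) T) := by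
  have hP := sylow_normal hφ P
  obtain ⟨a, ha⟩ := exists_tameCharacter_eq (φ := φ) P C
  rw [injective_iff_map_eq_one]
  intro x hx
  have h1 : tangentCoeff (φ x) ^ p ^ a = 1 := by
    have h2 : ((restrictToNormalizer (tameCharacter φ (P : Subgroup G) C) T x : kˣ) : k) =
        tangentCoeff (φ x) ^ p ^ a := ha _
    rw [← h2, hx, Units.val_one]
  exact Subtype.ext (eq_one_of_tangentCoeff_eq_one hφ hPC x.2.2
    (eq_one_of_pow_prime_pow_eq_one h1))

theorem takesValuesInPrimeField_of_isTeichmullerLift {A : Type*} [Group A] {η : A →* kˣ}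
    {ψ : A →* ℤ_[p]ˣ} (h : IsTeichmullerLift p η ψ) : TakesValuesInPrimeField p η := fun x =>
  ⟨Units.map (PadicInt.toZMod : ℤ_[p] →+* ZMod p).toMonoidHom (ψ x), (h x).symm⟩

end WildPart

end BertinObstruction

end

open BertinObstruction in
theorem theorem6p5 {p : ℕ} [Fact p.Prime] {k : Type*} [Field k] [IsAlgClosed k] [CharP k p]
    {G : Type*} [Group G] [Finite G]
    (φ : G →* (k⟦X⟧ ≃ₐ[k] k⟦X⟧)) (hφ : Function.Injective φ)
    (P : Sylow p G) (C : Subgroup G) (hPC : Subgroup.IsComplement' (P : Subgroup G) C) :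
    BertinVanishes φ ↔
      -- (a)
      BertinVanishes (φ.comp (P : Subgroup G).subtype) ∧
      -- (b)
      (∀ t ∈ C, t ≠ 1 →
        IsCyclic (Subgroup.centralizer ({t} : Set G)) ∧
        IsInternalProduct (Subgroup.centralizer ({t} : Set G) ⊓ (P : Subgroup G)) C
          (Subgroup.centralizer ({t} : Set G)) ∧
        IsInternalProduct (centralizerIn (P : Subgroup G) C) C
          (Subgroup.centralizer ({t} : Set G))) ∧
      -- (c)
      (∀ T : Subgroup G, T ≠ ⊥ → IsCyclic T → T ≤ (P : Subgroup G) →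
        ((T.relIndex (normalizerIn (P : Subgroup G) T) : ℤ) ∣ bPrime (P : Subgroup G) T) ∧
        ((T.relIndex (normalizerIn (P : Subgroup G) T) : ℚ) *
            bertinConstant (φ.comp (P : Subgroup G).subtype) (T.subgroupOf (P : Subgroup G)) ≥
          -(bPrime (P : Subgroup G) T : ℚ))) ∧
      -- (d)
      (∀ T : Subgroup G, T ≠ ⊥ → IsCyclic T → T ≤ (P : Subgroup G) →
        (centralizerIn C T ≠ ⊥ ∧
          (Nat.card (normalizerIn C T) : ℤ) ∣ bDoublePrime T) ∨
        (centralizerIn C T = ⊥ ∧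
          Function.Injective
            (restrictToNormalizer (tameCharacter φ (P : Subgroup G) C) T) ∧
          TakesValuesInPrimeField p
            (restrictToNormalizer (tameCharacter φ (P : Subgroup G) C) T) ∧
          IsTeichmullerLift p
            (restrictToNormalizer (tameCharacter φ (P : Subgroup G) C) T)
            (conjugationCharacter p C T)⁻¹ ∧
          (Nat.card (normalizerIn C T) : ℤ) ∣ bPrime (P : Subgroup G) T)) := by
  have hP := sylow_normal hφ P
  have hC := isCyclic_complement hφ hPC
  have hsplit : ∀ T : Subgroup G, T ≠ ⊥ → moebiusSum (ramificationOn φ) T =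
      moebiusSumIn (P : Subgroup G) (ramificationOn φ) T + bPrime (P : Subgroup G) T :=
    fun T hT => moebiusSum_eq_add_bPrime hT fun Γ hΓ hΓP => ramificationOn_eq_one hφ P hΓ hΓP
  constructor
  · intro hvan
    have ha := hvan.restrict hφ (P : Subgroup G)
    have hcrit := (bertinVanishes_iff hφ).1 hvan
    obtain ⟨S, _, _, hS⟩ := (bertinVanishes_iff_exists_isBertinSet hφ).1 hvan
    have hb : ∀ t ∈ C, t ≠ 1 → IsCyclic (Subgroup.centralizer ({t} : Set G)) := by
      intro t ht ht1
      obtain ⟨s, hs, -⟩ := hS.exists_centralizer_le_stabilizer hφ hPC ht ht1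
      have := (hS.1 s).2
      exact Subgroup.isCyclic_of_le hs
    refine ⟨ha, fun t ht ht1 =>
      ⟨hb t ht ht1, isInternalProduct_centralizer hPC hC ht (hb t ht ht1)⟩,
      fun T hT hTc hTP => ?_, fun T hT hTc hTP => ?_⟩
    · obtain ⟨h0, h1⟩ := hcrit T hT hTc
      rw [hsplit T hT] at h0 h1
      constructor
      · refine (dvd_add_right (relIndex_dvd_moebiusSumIn hφ ha hT hTc hTP)).1 (dvd_trans ?_ h1)
        exact Int.natCast_dvd_natCast.2 (relIndex_normalizerIn_dvd hTP)
      · rw [relIndex_mul_bertinConstant_restrict hφ hT hTc hTP, ge_iff_le, neg_le_iff_add_nonneg]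
        exact_mod_cast h0
    · have h1 : (Nat.card (normalizerIn C T) : ℤ) ∣
          moebiusSumIn (P : Subgroup G) (ramificationOn φ) T + bPrime (P : Subgroup G) T := by
        rw [← hsplit T hT]
        exact dvd_trans (Int.natCast_dvd_natCast.2 (card_normalizerIn_dvd hPC hTP))
          (hcrit T hT hTc).2
      by_cases hCT : centralizerIn C T = ⊥
      · have hrel := tangentCoeff_mul_eq_one_of_isBertinSet hφ hPC hS hT hTc hTP hCT
        have hlift := (isTeichmullerLift_inv_iff (P := P) (C := C) hφ T).2 hrel
        exact Or.inr ⟨hCT, injective_restrictToNormalizer hφ hPC T,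
          takesValuesInPrimeField_of_isTeichmullerLift hlift, hlift,
          (dvd_add_right (card_dvd_of_tangentCoeff_mul_eq_one hφ hPC hT hTc hTP hrel)).1 h1⟩
      · refine Or.inl ⟨hCT, ?_⟩
        obtain ⟨h2, h3⟩ :=
          normalizerIn_eq_and_card_dvd_of_centralizerIn_ne_bot hφ hPC hb hT hCT
        rw [h2] at h1 ⊢
        rw [bDoublePrime_eq_add_bPrime hT (P : Subgroup G)]
        have h4 := dvd_sub h1 h3
        rwa [add_sub_sub_cancel, add_comm] at h4
  · rintro ⟨ha, hb, hc, hd⟩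
    have hb : ∀ t ∈ C, t ≠ 1 → IsCyclic (Subgroup.centralizer ({t} : Set G)) :=
      fun t ht ht1 => (hb t ht ht1).1
    rw [bertinVanishes_iff hφ]
    intro T hT hTc
    by_cases hTP : T ≤ (P : Subgroup G)
    · -- pass to a conjugate of `T` whose normalizer is adapted to the decomposition of `G`
      obtain ⟨z, T', hT', hTP', hrel⟩ := exists_conj_relIndex_normalizer_eq hPC hC hTP
      have hT'c : IsCyclic T' := hT' ▸ isCyclic_map_conj hTc z
      have hT'0 : T' ≠ ⊥ := by
        rw [hT', Ne, Subgroup.map_eq_bot_iff_of_injective T (MulAut.conj z).injective]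
        exact hT
      rw [← moebiusSum_map_conj (ramificationOn_map_conj φ) T z,
        ← relIndex_normalizer_map_conj T z, ← hT', hsplit T' hT'0]
      obtain ⟨hc1, hc2⟩ := hc T' hT'0 hT'c hTP'
      constructor
      · rw [relIndex_mul_bertinConstant_restrict hφ hT'0 hT'c hTP', ge_iff_le,
          neg_le_iff_add_nonneg] at hc2
        exact_mod_cast hc2
      · rw [hrel, Nat.cast_mul]
        have hcop : IsCoprime (T'.relIndex (normalizerIn (P : Subgroup G) T') : ℤ)
            (Nat.card (normalizerIn C T') : ℤ) := by
          rw [Nat.isCoprime_iff_coprime]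
          obtain ⟨n, hn⟩ := P.2.exists_card_eq
          have h1 : T'.relIndex (normalizerIn (P : Subgroup G) T') ∣ p ^ n := by
            rw [← hn]
            exact (Subgroup.relIndex_dvd_card _ _).trans (Subgroup.card_dvd_of_le inf_le_right)
          exact (((card_complement_coprime hPC).coprime_dvd_left
            (Subgroup.card_dvd_of_le inf_le_right)).pow_right n).symm.coprime_dvd_left h1
        refine hcop.mul_dvd (dvd_add (relIndex_dvd_moebiusSumIn hφ ha hT'0 hT'c hTP') hc1) ?_
        rcases hd T' hT'0 hT'c hTP' with ⟨hCT, h1⟩ | ⟨-, -, -, hlift, h1⟩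
        · obtain ⟨h2, h3⟩ :=
            normalizerIn_eq_and_card_dvd_of_centralizerIn_ne_bot hφ hPC hb hT'0 hCT
          rw [h2, bDoublePrime_eq_add_bPrime hT'0 (P : Subgroup G)] at h1
          rw [h2]
          have h4 := dvd_add h1 h3
          convert h4 using 1
          ring
        · exact dvd_add (card_dvd_of_tangentCoeff_mul_eq_one hφ hPC hT'0 hT'c hTP'
            ((isTeichmullerLift_inv_iff hφ T').1 hlift)) h1
    · exact moebiusSum_of_not_le hφ hPC hb hTc hTP
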